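/- **Setting.** A Fréchet space $(F,d)$ is always given with a complete translation-invariant metric $d$ defining its topology whose balls are absolutely convex; write $\|f\|=d(f,0)$, and give products the maximum metric. $\mathcal L(E,F)$ denotes the group of linear maps $L:E\to F$ with $\|L\|=\sup_{x\ne0}\|Lx\|/\|x\|<\infty$, with the metric $\|L-H\|$, and $\mathcal L(E,F)_0$ the connected component of $0$. A map $P:U\to F$ ($U\subseteq E$ open) is $MC^0$ if it is continuous; it is $MC^{k+1}$ if it is continuous, has directional derivatives given by a continuous map $P':U\to\mathcal L(E,F)$, and every $x_0\in U$ has a connected open neighbourhood $V\subseteq U$ such that $P'-P'(x_0):V\to\mathcal L(E,F)_0$ is $MC^k$. "Smooth" means $MC^\infty$; a map $T$ into $\mathcal L(E,F)$ is smooth if locally $T-T(x_0)$ is smooth as a map into $\mathcal L(E,F)_0$. Let $M$ be a bounded Fréchet manifold modelled on $F$, i.e. a Hausdorff second countable space with an atlas $\{(U_\alpha,\varphi_\alpha)\}$ of charts in $F$ whose coordinate changes are $MC^\infty$. Let $TM$ and $T^2M$ be the sets of $1$-jets and $2$-jets at $0$ of infinitely differentiable curves $f:\mathbb R\to M$, with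 the manifold structures given by the charts $$j^1f\mapsto(\varphi_\alpha(f(0)),(\varphi_\alpha\circ f)'(0)),\qquad j^2f\mapsto(\varphi_\alpha(f(0)),(\varphi_\alpha\circ f)'(0),(\varphi_\alpha\circ f)''(0)),$$ and let $T(TM)$ be obtained in the same way from the manifold $TM$. A vector bundle structure on a manifold $X\to M$ with fibre $V$ is given by an open cover of $M$ with smooth trivializations (diffeomorphisms over the base) whose transition maps take values in the automorphisms of $V$ and are smooth as maps into $\mathcal L(V,V)$; vector bundle morphisms over $\mathrm{id}_M$ are fibrewise in $\mathcal L$ and depend smoothly, as elements of $\mathcal L$, on the base point. A connection on $M$ is a smooth map $\mathcal K:T(TM)\to TM$ over $M$ which in the charts has the form $(f,g,h,k)\mapsto(f,k+\tau_\alpha(f,g)h)$ with $\tau_\alpha:\varphi_\alpha(U_\alpha)\times F\to\mathcal L(F,F)$ smooth. It is linear if each $\tau_\alpha$ is linear in the second variable; its Christoffel symbols are then $\Gamma_\alpha(f)(g,h)=\tau_\alpha(f,g)h$. **Theorem.** Suppose that $T^2M\to M$ admits a vector bundle structure with fibre $F\times F$ (compatible with its manifold structure) and a vector bundle isomorphism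 $\Psi:T^2M\to TM\oplus TM$ over $\mathrm{id}_M$. Then there exists a linear connection on $M$, with Christoffel symbols $\Gamma_\alpha:\varphi_\alpha(U_\alpha)\to\mathcal L(F,\mathcal L(F,F))\cong\mathcal L(F\times F;F)$ satisfying the compatibility condition $$\Gamma_\alpha(\Theta(f))\big(D\Theta(f)g,D\Theta(f)h\big)+\big(D^2\Theta(f)h\big)g=D\Theta(f)\big(\Gamma_\beta(f)(g,h)\big),\qquad \Theta=\varphi_\alpha\circ\varphi_\beta^{-1},$$ for all $f\in\varphi_\beta(U_\alpha\cap U_\beta)$ and $g,h\in F$. The connection can be chosen such that all $\Gamma_\alpha(f)$ are symmetric and are read off from the trivializations in the following sense. Let $p\in U_\alpha$, let $(\Omega^1,\Omega^2):T^2_pM\to F\times F$ be $\Psi$ followed by the trivialization of $TM\oplus TM$ induced by $\varphi_\alpha$, and suppose that there are a linear map $L:F\to F$ and a bilinear map $b:F\times F\to F$ with $$\Omega^1(j^2f)=L\big((\varphi_\alpha\circ f)'(0)\big),\qquad \Omega^2(j^2f)-L\big((\varphi_\alpha\circ f)''(0)\big)=b\big((\varphi_\alpha\circ f)'(0),(\varphi_\alpha\circ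 f)'(0)\big)$$ for all $j^2f\in T^2_pM$. Then $L\,\Gamma_\alpha(\varphi_\alpha(p))(u,u)=b(u,u)$ for all $u\in F$; that is, in the chart $L\circ\varphi_\alpha$ the Christoffel symbol at $p$ on $(u,u)$ is $\Omega^2(j^2f)-(L\circ\varphi_\alpha\circ f)''(0)$. -/

import Mathlib

open Set Filter Topology

universe u v w

noncomputable section

/-! ### Fréchet spaces with a standard metric

A translation-invariant metric `d` on a vector space is a `NormedAddCommGroup` structure, with
`‖f‖ = d (f, 0)`; homogeneity of `‖·‖` is *not* assumed.  A Fréchet space is such a space that is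
moreover complete, with continuous scalar multiplication (`CompleteSpace`, `ContinuousSMul ℝ`),
and whose metric is standard in the following sense. -/

/-- The metric is standard: its balls are absolutely convex. -/
class StandardMetric (F : Type u) [NormedAddCommGroup F] [Module ℝ F] : Prop where
  absConvex_ball : ∀ r : ℝ, AbsConvex ℝ (Metric.ball (0 : F) r)

section StandardMetric

variable {F : Type u} [NormedAddCommGroup F] [Module ℝ F]

theorem StandardMetric.comb_mem_ball [StandardMetric F] {a b : ℝ} (hab : |a| + |b| ≤ 1) (r : ℝ)
    {x y : F} (hx : x ∈ Metric.ball (0 : F) r) (hy : y ∈ Metric.ball (0 : F) r) :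
    a • x + b • y ∈ Metric.ball (0 : F) r := by
  have hB := StandardMetric.absConvex_ball (F := F) r
  have h0 : (0 : F) ∈ Metric.ball (0 : F) r := by
    simpa using hB.1.smul_mem (a := (0 : ℝ)) (by simp) hx
  have key : ∀ c : ℝ, ∀ z ∈ Metric.ball (0 : F) r, ∃ z' ∈ Metric.ball (0 : F) r,
      c • z = |c| • z' := by
    intro c z hz
    rcases abs_choice c with h | h
    · exact ⟨z, hz, by rw [h]⟩
    · refine ⟨(-1 : ℝ) • z, hB.1.smul_mem (by simp) hz, ?_⟩
      rw [h, smul_smul]; simp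
  obtain ⟨x', hx', ex⟩ := key a x hx
  obtain ⟨y', hy', ey⟩ := key b y hy
  rw [ex, ey]
  have := hB.2.sum_mem (t := Finset.univ) (w := ![|a|, |b|, 1 - |a| - |b|]) (z := ![x', y', 0])
    (by intro i _; fin_cases i <;> (simp; try linarith))
    (by simp [Fin.sum_univ_three])
    (by intro i _; fin_cases i <;> simp_all)
  simpa [Fin.sum_univ_three] using this

theorem StandardMetric.norm_comb_le [StandardMetric F] {a b : ℝ} (hab : |a| + |b| ≤ 1) (x y : F) :
    ‖a • x + b • y‖ ≤ max ‖x‖ ‖y‖ := by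
  refine le_of_forall_gt fun r hr => ?_
  have hx : x ∈ Metric.ball (0 : F) r := by simpa using (le_max_left _ _).trans_lt hr
  have hy : y ∈ Metric.ball (0 : F) r := by simpa using (le_max_right _ _).trans_lt hr
  simpa using StandardMetric.comb_mem_ball hab r hx hy

theorem StandardMetric.of_norm_comb_le
    (h : ∀ (a b : ℝ), |a| + |b| ≤ 1 → ∀ x y : F, ‖a • x + b • y‖ ≤ max ‖x‖ ‖y‖) :
    StandardMetric F := by
  refine ⟨fun r => ⟨?_, ?_⟩⟩
  · rw [balanced_iff_smul_mem]
    intro a ha x hx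
    have := h a 0 (by simpa using ha) x x
    simp only [zero_smul, add_zero, max_self] at this
    simp only [mem_ball_zero_iff] at hx ⊢
    exact this.trans_lt hx
  · rw [convex_iff_add_mem]
    intro x hx y hy a b ha hb hab
    have := h a b (by rw [abs_of_nonneg ha, abs_of_nonneg hb, hab]) x y
    simp only [mem_ball_zero_iff] at hx hy ⊢
    exact this.trans_lt (max_lt hx hy)

theorem StandardMetric.norm_smul_le [StandardMetric F] {a : ℝ} (ha : |a| ≤ 1) (x : F) :
    ‖a • x‖ ≤ ‖x‖ := by
  simpa using StandardMetric.norm_comb_le (a := a) (b := 0) (by simpa using ha) x x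

theorem StandardMetric.norm_smul_le_ceil [StandardMetric F] (c : ℝ) (x : F) :
    ‖c • x‖ ≤ (⌈|c|⌉₊ : ℝ) * ‖x‖ := by
  rcases eq_or_ne c 0 with rfl | hc
  · simp
  have hn : (0 : ℝ) < ⌈|c|⌉₊ := by exact_mod_cast Nat.ceil_pos.2 (abs_pos.2 hc)
  have e : c • x = ⌈|c|⌉₊ • ((c / ⌈|c|⌉₊) • x) := by
    rw [← Nat.cast_smul_eq_nsmul ℝ, smul_smul, mul_div_cancel₀ _ hn.ne']
  rw [e]
  calc ‖⌈|c|⌉₊ • ((c / ⌈|c|⌉₊) • x)‖ ≤ ⌈|c|⌉₊ * ‖(c / ⌈|c|⌉₊) • x‖ := norm_nsmul_le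
    _ ≤ _ := by
      gcongr
      refine StandardMetric.norm_smul_le ?_ x
      rw [abs_div, abs_of_pos hn, div_le_one hn]
      exact Nat.le_ceil _

/-- A product carries the maximum metric. -/
instance {E : Type v} [NormedAddCommGroup E] [Module ℝ E] [StandardMetric E] [StandardMetric F] :
    StandardMetric (E × F) := by
  refine StandardMetric.of_norm_comb_le fun a b hab x y => ?_
  refine max_le ?_ ?_
  · exact (StandardMetric.norm_comb_le hab x.1 y.1).trans
      (max_le_max (norm_fst_le x) (norm_fst_le y))
  · exact (StandardMetric.norm_comb_le hab x.2 y.2).trans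
      (max_le_max (norm_snd_le x) (norm_snd_le y))

instance (p : Submodule ℝ F) [StandardMetric F] : StandardMetric p :=
  StandardMetric.of_norm_comb_le fun _ _ hab x y =>
    StandardMetric.norm_comb_le hab (x : F) (y : F)

end StandardMetric

/-! ### The vector group of Lipschitz linear maps -/

section Lip

variable (E : Type v) [NormedAddCommGroup E] [Module ℝ E]
variable (F : Type u) [NormedAddCommGroup F] [Module ℝ F] [StandardMetric F]

/-- `𝓛(E, F)`: the globally Lipschitz linear maps `E → F`. -/
def lipSubmodule : Submodule ℝ (E →ₗ[ℝ] F) where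
  carrier := {L | ∃ C : ℝ, ∀ x, ‖L x‖ ≤ C * ‖x‖}
  zero_mem' := ⟨0, by simp⟩
  add_mem' := by
    rintro L H ⟨C, hC⟩ ⟨D, hD⟩
    refine ⟨C + D, fun x => ?_⟩
    rw [add_mul]
    exact (norm_add_le _ _).trans (add_le_add (hC x) (hD x))
  smul_mem' := by
    rintro c L ⟨C, hC⟩
    refine ⟨⌈|c|⌉₊ * C, fun x => ?_⟩
    rw [mul_assoc]
    exact (StandardMetric.norm_smul_le_ceil c (L x)).trans (by gcongr; exact hC x)

/-- `𝓛(E, F)` as a type. -/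
abbrev Lip : Type max u v := ↥(lipSubmodule E F)

instance : CoeFun (Lip E F) (fun _ => E → F) := ⟨fun L => L.1⟩

variable {E F}

/-- `‖L‖ = sup_{x ≠ 0} ‖L x‖ / ‖x‖` (the quotient is `0` at `x = 0`). -/
def Lip.opNorm (L : Lip E F) : ℝ := ⨆ x : E, ‖L x‖ / ‖x‖

theorem Lip.bddAbove (L : Lip E F) : BddAbove (range fun x : E => ‖L x‖ / ‖x‖) := by
  obtain ⟨C, hC⟩ := L.2
  refine ⟨max C 0, ?_⟩
  rintro _ ⟨x, rfl⟩
  rcases eq_or_ne x 0 with rfl | hx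
  · simp
  · exact le_max_of_le_left ((div_le_iff₀ (norm_pos_iff.2 hx)).2 (hC x))

theorem Lip.opNorm_nonneg (L : Lip E F) : 0 ≤ L.opNorm :=
  Real.iSup_nonneg fun _ => by positivity

theorem Lip.le_opNorm (L : Lip E F) (x : E) : ‖L x‖ ≤ L.opNorm * ‖x‖ := by
  rcases eq_or_ne x 0 with rfl | hx
  · simp
  · exact (div_le_iff₀ (norm_pos_iff.2 hx)).1 (le_ciSup L.bddAbove x)

theorem Lip.opNorm_le (L : Lip E F) {C : ℝ} (hC : 0 ≤ C) (h : ∀ x, ‖L x‖ ≤ C * ‖x‖) :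
    L.opNorm ≤ C := by
  refine ciSup_le fun x => ?_
  rcases eq_or_ne x 0 with rfl | hx
  · simpa using hC
  · exact (div_le_iff₀ (norm_pos_iff.2 hx)).2 (h x)

/-- The translation-invariant metric `D(L, H) = ‖L - H‖` on `𝓛(E, F)`. -/
instance : NormedAddCommGroup (Lip E F) :=
  AddGroupNorm.toNormedAddCommGroup
    { toFun := Lip.opNorm
      map_zero' := le_antisymm
        (Lip.opNorm_le _ le_rfl (by simp)) (Lip.opNorm_nonneg _)
      add_le' := fun L H => Lip.opNorm_le _ (add_nonneg L.opNorm_nonneg H.opNorm_nonneg)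
        fun x => by
          rw [add_mul]
          exact (norm_add_le _ _).trans (add_le_add (L.le_opNorm x) (H.le_opNorm x))
      neg' := fun L => by simp [Lip.opNorm]
      eq_zero_of_map_eq_zero' := fun L h => by
        ext x
        have := L.le_opNorm x
        rw [h, zero_mul] at this
        exact norm_le_zero_iff.1 this }

theorem Lip.norm_def (L : Lip E F) : ‖L‖ = ⨆ x : E, ‖L x‖ / ‖x‖ := rfl

instance : StandardMetric (Lip E F) := by
  refine StandardMetric.of_norm_comb_le fun a b hab L H => ?_
  refine Lip.opNorm_le _ (le_max_of_le_left L.opNorm_nonneg) fun x => ?_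
  refine (StandardMetric.norm_comb_le hab (L x) (H x)).trans ?_
  rw [max_mul_of_nonneg _ _ (norm_nonneg x)]
  exact max_le_max (L.le_opNorm x) (H.le_opNorm x)

variable (E F)

/-- `𝓛(E, F)₀`: the connected component of `0` in the topological group `𝓛(E, F)`. -/
def LipZero : Submodule ℝ (Lip E F) where
  __ := AddSubgroup.connectedComponentOfZero (Lip E F)
  smul_mem' := by
    intro c L hL
    have hc : Continuous fun H : Lip E F => c • H := by
      refine AddMonoidHomClass.continuous_of_bound (DistribSMul.toAddMonoidHom (Lip E F) c)
        (⌈|c|⌉₊ : ℝ) fun H => ?_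
      exact StandardMetric.norm_smul_le_ceil c H
    have := hc.image_connectedComponent_subset (0 : Lip E F) (mem_image_of_mem _ hL)
    rwa [smul_zero] at this

end Lip

/-! ### `MC^k` maps -/

section MC

/-- `P` has directional derivative `y` at `p` in the direction `h`. -/
def HasDirDeriv {E : Type v} [AddCommGroup E] [Module ℝ E]
    {F : Type u} [NormedAddCommGroup F] [Module ℝ F] (P : E → F) (p h : E) (y : F) : Prop :=
  Tendsto (fun t : ℝ => t⁻¹ • (P (p + t • h) - P p)) (𝓝[≠] 0) (𝓝 y)

/-- The directional derivative `D P(p)(h)`. -/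
def dirDeriv {E : Type v} [AddCommGroup E] [Module ℝ E]
    {F : Type u} [NormedAddCommGroup F] [Module ℝ F] (P : E → F) (p h : E) : F :=
  limUnder (𝓝[≠] (0 : ℝ)) fun t : ℝ => t⁻¹ • (P (p + t • h) - P p)

variable {E : Type u} [NormedAddCommGroup E] [Module ℝ E]

/-- `P` is b-differentiable on the open set `U` with derivative `P' : U → 𝓛(E, F)`.  (Continuity
of `P'` makes `(p, h) ↦ D P(p)(h)` continuous, so that `P` is Keller-differentiable.) -/
structure IsBDiff {F : Type u} [NormedAddCommGroup F] [Module ℝ F] [StandardMetric F]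
    (P : E → F) (P' : E → Lip E F) (U : Set E) : Prop where
  continuousOn : ContinuousOn P U
  hasDirDeriv : ∀ p ∈ U, ∀ h : E, HasDirDeriv P p h (P' p h)
  continuousOn_deriv : ContinuousOn P' U

/-- `P` is an `MC^k` map on the open set `U`: for `k = 0` it is continuous; it is `MC^{k+1}` if it
is b-differentiable and each `x₀ ∈ U` has a connected open neighbourhood `V ⊆ U` such that
`P' - P' x₀ : V → 𝓛(E, F)₀` is `MC^k`. -/
def IsMC : ℕ → ∀ {F : Type u} [NormedAddCommGroup F] [Module ℝ F] [StandardMetric F],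
    (E → F) → Set E → Prop
  | 0, _, _, _, _, P, U => ContinuousOn P U
  | k + 1, F, _, _, _, P, U => ∃ P' : E → Lip E F, IsBDiff P P' U ∧
      ∀ x₀ ∈ U, ∃ V : Set E, IsOpen V ∧ IsConnected V ∧ x₀ ∈ V ∧ V ⊆ U ∧
        ∃ Q : E → LipZero E F, (∀ x ∈ V, (Q x : Lip E F) = P' x - P' x₀) ∧ IsMC k Q V

/-- `P` is an `MC^∞` map on the open set `U`. -/
def IsMCInf {F : Type u} [NormedAddCommGroup F] [Module ℝ F] [StandardMetric F]
    (P : E → F) (U : Set E) : Prop :=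
  ∀ k, IsMC k P U

/-- A map `T` from the open set `U` to the topological group `𝓛(E₁, E₂)` is `MC^∞`: locally,
`T - T x₀` is an `MC^∞` map into the identity component `𝓛(E₁, E₂)₀`. -/
def IsMCInfLip {E₁ E₂ : Type u} [NormedAddCommGroup E₁] [Module ℝ E₁]
    [NormedAddCommGroup E₂] [Module ℝ E₂] [StandardMetric E₂]
    (T : E → Lip E₁ E₂) (U : Set E) : Prop :=
  ∀ x₀ ∈ U, ∃ V : Set E, IsOpen V ∧ IsConnected V ∧ x₀ ∈ V ∧ V ⊆ U ∧
    ∃ Q : E → LipZero E₁ E₂, (∀ x ∈ V, (Q x : Lip E₁ E₂) = T x - T x₀) ∧ IsMCInf Q V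

end MC

/-! ### Bounded Fréchet manifolds -/

/-- `M` is a bounded Fréchet manifold modelled on `F`: Hausdorff, second countable, and the
coordinate changes of its atlas are `MC^∞`. -/
class BoundedFrechetManifold (F : Type u) [NormedAddCommGroup F] [Module ℝ F] [StandardMetric F]
    (M : Type v) [TopologicalSpace M] [ChartedSpace F M] : Prop
    extends T2Space M, SecondCountableTopology M where
  isMCInf_coordChange : ∀ e ∈ atlas F M, ∀ e' ∈ atlas F M,
    IsMCInf (e' ∘ e.symm) (e.symm.trans e').source

/-- A family of coordinate systems, indexed by `ι` and with values in `E`, on a set `X`; the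
differentiable structures of `M`, `TM`, `T²M`, `T(TM)`, `TM ⊕ TM` are given in this way. -/
structure Charts (ι : Type w) (X : Type v) (E : Type u) where
  /-- the domains of the charts -/
  dom : ι → Set X
  /-- the coordinates -/
  coord : ι → X → E

/-- The charts of the atlas of a manifold `M`. -/
def manifoldCharts (F : Type u) [TopologicalSpace F] (M : Type v) [TopologicalSpace M]
    [ChartedSpace F M] : Charts (atlas F M) M F where
  dom e := e.1.source
  coord e := e.1

namespace Charts

variable {ι : Type w} {X : Type v} {E : Type u}

/-- The image `φ_i(U_i)` of a chart. -/
def target (A : Charts ι X E) (i : ι) : Set E := A.coord i '' A.dom i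

/-- Restriction of charts to a subset. -/
def restrict (A : Charts ι X E) (S : Set X) : Charts ι S E where
  dom i := {x | (x : X) ∈ A.dom i}
  coord i x := A.coord i x

/-- Charts of the product with a vector space `V`. -/
def prod (A : Charts ι X E) (V : Type*) : Charts ι (X × V) (E × V) where
  dom i := {z | z.1 ∈ A.dom i}
  coord i z := (A.coord i z.1, z.2)

end Charts

section Maps

variable {ι : Type w} {X : Type v} {E : Type u} [NormedAddCommGroup E] [Module ℝ E]
variable {ι' : Type*} {X' : Type*} {E' : Type u} [NormedAddCommGroup E'] [Module ℝ E']
  [StandardMetric E']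

/-- `h : X → X'` is a smooth (`MC^∞`) map: every local representative is defined on an open set
and is `MC^∞` there. -/
def IsMCMap (A : Charts ι X E) (A' : Charts ι' X' E') (h : X → X') : Prop :=
  ∀ i j, IsOpen (A.coord i '' (A.dom i ∩ h ⁻¹' A'.dom j)) ∧
    ∃ G : E → E', IsMCInf G (A.coord i '' (A.dom i ∩ h ⁻¹' A'.dom j)) ∧
      ∀ x ∈ A.dom i ∩ h ⁻¹' A'.dom j, A'.coord j (h x) = G (A.coord i x)

/-- `h` is an `MC^∞` diffeomorphism. -/
def IsMCDiffeo [StandardMetric E] (A : Charts ι X E) (A' : Charts ι' X' E') (h : X ≃ X') : Prop :=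
  IsMCMap A A' h ∧ IsMCMap A' A h.symm

/-- A map `T` from the open subset `S` of the manifold `X` to `𝓛(E₁, E₂)` is smooth. -/
def IsMCMapLip {E₁ E₂ : Type u} [NormedAddCommGroup E₁] [Module ℝ E₁]
    [NormedAddCommGroup E₂] [Module ℝ E₂] [StandardMetric E₂]
    (A : Charts ι X E) (T : X → Lip E₁ E₂) (S : Set X) : Prop :=
  ∀ i, ∃ G : E → Lip E₁ E₂, IsMCInfLip G (A.coord i '' (A.dom i ∩ S)) ∧
    ∀ x ∈ A.dom i ∩ S, T x = G (A.coord i x)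

end Maps

/-! ### Jets of curves, `TM` and `T²M` -/

section Jets

variable {ι : Type w} {X : Type v} {E : Type u} [NormedAddCommGroup E] [Module ℝ E]

/-- The derivative of a curve. -/
def curveDeriv (c : ℝ → E) (t : ℝ) : E := dirDeriv c t 1

/-- `f : ℝ → X` is a smooth curve: it is continuous (`f` stays in a chart for a short time) and in
each chart it has derivatives of all orders. -/
def IsSmoothCurve (A : Charts ι X E) (f : ℝ → X) : Prop :=
  ∀ i t, f t ∈ A.dom i → (∀ᶠ s in 𝓝 t, f s ∈ A.dom i) ∧
    ∀ k : ℕ, ∃ y : E, HasDirDeriv (curveDeriv^[k] (A.coord i ∘ f)) t 1 y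

/-- Two smooth curves have the same `r`-jet at `0`: they agree at `0` and, in the charts around
this point, so do their derivatives up to order `r` at `0`. -/
def jetSetoid (A : Charts ι X E) (r : ℕ) : Setoid {f : ℝ → X // IsSmoothCurve A f} where
  r f g := f.1 0 = g.1 0 ∧ ∀ i, f.1 0 ∈ A.dom i → ∀ m, 1 ≤ m → m ≤ r →
    curveDeriv^[m] (A.coord i ∘ f.1) 0 = curveDeriv^[m] (A.coord i ∘ g.1) 0
  iseqv :=
    { refl := fun _ => ⟨rfl, fun _ _ _ _ _ => rfl⟩
      symm := fun h => ⟨h.1.symm, fun i hi m h1 h2 => (h.2 i (h.1 ▸ hi) m h1 h2).symm⟩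
      trans := fun h h' => ⟨h.1.trans h'.1, fun i hi m h1 h2 =>
        (h.2 i hi m h1 h2).trans (h'.2 i (h.1 ▸ hi) m h1 h2)⟩ }

/-- The set of all `r`-jets of smooth curves in `X`. -/
def Jet (A : Charts ι X E) (r : ℕ) : Type v := Quotient (jetSetoid A r)

/-- The `r`-jet of a smooth curve at `0`. -/
def Jet.mk (A : Charts ι X E) (r : ℕ) (f : ℝ → X) (hf : IsSmoothCurve A f) : Jet A r :=
  Quotient.mk (jetSetoid A r) ⟨f, hf⟩

/-- The base point `f 0` of the jet of `f`. -/
def Jet.base {A : Charts ι X E} {r : ℕ} (ξ : Jet A r) : X :=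
  Quotient.lift (s := jetSetoid A r) (fun f => f.1 0) (fun _ _ h => h.1) ξ

/-- The `m`-th derivative at `0` in the chart `i` of a curve representing the jet; it does not
depend on the representative when `1 ≤ m ≤ r` and the base point is in the domain of the chart. -/
def Jet.deriv {A : Charts ι X E} {r : ℕ} (i : ι) (m : ℕ) (ξ : Jet A r) : E :=
  curveDeriv^[m] (A.coord i ∘ (Quotient.out (s := jetSetoid A r) ξ).1) 0

theorem Jet.base_mk (A : Charts ι X E) (r : ℕ) (f : ℝ → X) (hf : IsSmoothCurve A f) :
    (Jet.mk A r f hf).base = f 0 := rfl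

theorem Jet.deriv_mk (A : Charts ι X E) (r : ℕ) (f : ℝ → X) (hf : IsSmoothCurve A f) (i : ι)
    (hi : f 0 ∈ A.dom i) (m : ℕ) (h1 : 1 ≤ m) (h2 : m ≤ r) :
    (Jet.mk A r f hf).deriv i m = curveDeriv^[m] (A.coord i ∘ f) 0 := by
  have h := Quotient.mk_out (s := jetSetoid A r) ⟨f, hf⟩
  exact ((jetSetoid A r).symm h |>.2 i hi m h1 h2).symm

/-- The tangent bundle: all `1`-jets. -/
abbrev TBundle (A : Charts ι X E) : Type v := Jet A 1

/-- The second order tangent bundle: all `2`-jets. -/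
abbrev T2Bundle (A : Charts ι X E) : Type v := Jet A 2

/-- The charts `j¹f ↦ (φ_i(f 0), (φ_i ∘ f)'(0))` of the tangent bundle. -/
def tangentCharts (A : Charts ι X E) : Charts ι (TBundle A) (E × E) where
  dom i := {ξ | ξ.base ∈ A.dom i}
  coord i ξ := (A.coord i ξ.base, ξ.deriv i 1)

/-- The charts `j²f ↦ (φ_i(f 0), ((φ_i ∘ f)'(0), (φ_i ∘ f)''(0)))` of the second order tangent
bundle. -/
def tangent2Charts (A : Charts ι X E) : Charts ι (T2Bundle A) (E × E × E) where
  dom i := {ξ | ξ.base ∈ A.dom i}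
  coord i ξ := (A.coord i ξ.base, ξ.deriv i 1, ξ.deriv i 2)

end Jets

/-! ### Vector bundles -/

section Bundles

/-- A family of trivializations for a map `X → M` with fibre type `V`: for each `k : κ` a set
`U_k` in the base and the fibre component of a trivialization over `U_k`. -/
structure Trivs (κ : Type*) (M : Type*) (X : Type*) (V : Type*) where
  /-- the sets `U_k` -/
  base : κ → Set M
  /-- the fibre components -/
  fib : κ → X → V

variable {ι : Type w} {M : Type v} {E : Type u} [NormedAddCommGroup E] [Module ℝ E]
variable {X X' : Type*}
variable {V V' : Type u} [NormedAddCommGroup V] [Module ℝ V] [StandardMetric V]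
  [NormedAddCommGroup V'] [Module ℝ V'] [StandardMetric V']
variable {κ κ' : Type*}

/-- `Ψ : X → X'` is a morphism over `id_M` from the bundle `(π, 𝒯)` to the bundle `(π', 𝒯')`: it
covers the identity, on fibres it is given in trivializations by Lipschitz linear maps, and these
depend smoothly on the base point. -/
def IsBundleMorphism (A : Charts ι M E) (π : X → M) (𝒯 : Trivs κ M X V)
    (π' : X' → M) (𝒯' : Trivs κ' M X' V') (Ψ : X → X') : Prop :=
  (∀ ξ, π' (Ψ ξ) = π ξ) ∧
  ∀ k l, ∃ T : M → Lip V V', IsMCMapLip A T (𝒯.base k ∩ 𝒯'.base l) ∧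
    ∀ ξ, π ξ ∈ 𝒯.base k ∩ 𝒯'.base l → 𝒯'.fib l (Ψ ξ) = T (π ξ) (𝒯.fib k ξ)

/-- `Ψ : X ≃ X'` is an isomorphism over `id_M` of bundles. -/
def IsBundleIso (A : Charts ι M E) (π : X → M) (𝒯 : Trivs κ M X V)
    (π' : X' → M) (𝒯' : Trivs κ' M X' V') (Ψ : X ≃ X') : Prop :=
  IsBundleMorphism A π 𝒯 π' 𝒯' Ψ ∧ IsBundleMorphism A π' 𝒯' π 𝒯 Ψ.symm

/-- `𝒯` is a trivializing atlas making the manifold `X` (with charts `B`) a vector bundle over the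
manifold `M` (with charts `A`), with projection `π` and fibre type `V`: the `U_k` are open and
cover `M`; over `U_k`, `ξ ↦ (π ξ, fib_k ξ)` is a diffeomorphism `π⁻¹(U_k) → U_k × V`; the fibre
parts of the changes of trivialization are linear automorphisms, Lipschitz in both directions,
that depend smoothly on the base point as elements of `𝓛(V, V)`. -/
structure IsVectorBundle [StandardMetric E] [TopologicalSpace M] {ι' : Type*} {E' : Type u}
    [NormedAddCommGroup E'] [Module ℝ E'] [StandardMetric E']
    (A : Charts ι M E) (B : Charts ι' X E') (π : X → M) (𝒯 : Trivs κ M X V) : Prop where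
  isOpen_base : ∀ k, IsOpen (𝒯.base k)
  cover : ∀ p, ∃ k, p ∈ 𝒯.base k
  triv : ∀ k, ∃ τ : ↥(π ⁻¹' 𝒯.base k) ≃ ↥(𝒯.base k) × V,
    (∀ ξ, ((τ ξ).1 : M) = π ξ ∧ (τ ξ).2 = 𝒯.fib k ξ) ∧
    IsMCDiffeo (B.restrict (π ⁻¹' 𝒯.base k)) ((A.restrict (𝒯.base k)).prod V) τ
  transition : IsBundleMorphism A π 𝒯 π 𝒯 id

/-- The Whitney sum `TM ⊕ TM`. -/
def WhitneyT (A : Charts ι M E) : Type v :=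
  {z : TBundle A × TBundle A // z.1.base = z.2.base}

/-- The projection `TM ⊕ TM → M`. -/
def WhitneyT.proj {A : Charts ι M E} (z : WhitneyT A) : M := z.1.1.base

/-- The standard trivializations of the vector bundle `TM ⊕ TM`, induced by the charts of `M`:
`(j¹f, j¹g) ↦ ((φ_i ∘ f)'(0), (φ_i ∘ g)'(0))`. -/
def whitneyTrivs (A : Charts ι M E) : Trivs ι M (WhitneyT A) (E × E) where
  base := A.dom
  fib i z := (z.1.1.deriv i 1, z.1.2.deriv i 1)

end Bundles

/-! ### Connections -/

section Connections

variable {ι : Type w} {M : Type v} {E : Type u} [NormedAddCommGroup E] [Module ℝ E]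
  [StandardMetric E]

/-- `K : T(TM) → TM` is a connection map with local components
`τ_i : φ_i(U_i) × E → 𝓛(E, E)`: it is a smooth bundle morphism, the `τ_i` are smooth, and in the
charts `K` reads `(f, g, h, k) ↦ (f, k + τ_i(f, g) h)`. -/
structure IsConnection (A : Charts ι M E) (K : TBundle (tangentCharts A) → TBundle A)
    (τ : ι → E × E → Lip E E) : Prop where
  smooth : IsMCMap (tangentCharts (tangentCharts A)) (tangentCharts A) K
  base_eq : ∀ ξ, (K ξ).base = ξ.base.base
  smooth_local : ∀ i, IsMCInfLip (τ i) (A.target i ×ˢ univ)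
  local_eq : ∀ i, ∀ ξ : TBundle (tangentCharts A), ξ.base.base ∈ A.dom i →
    ∀ f g h k : E, (tangentCharts (tangentCharts A)).coord i ξ = ((f, g), (h, k)) →
      (tangentCharts A).coord i (K ξ) = (f, k + τ i (f, g) h)

/-- A connection is linear if its local components are linear in the second variable. -/
structure IsLinearConnection (A : Charts ι M E) (K : TBundle (tangentCharts A) → TBundle A)
    (τ : ι → E × E → Lip E E) : Prop extends IsConnection A K τ where
  linear : ∀ i, ∀ f ∈ A.target i, IsLinearMap ℝ fun g : E => τ i (f, g)

/-- `Γ_i : φ_i(U_i) → 𝓛(E, E; E) ≅ 𝓛(E, 𝓛(E, E))` are the Christoffel symbols of a linear connection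
with local components `τ`. -/
def IsChristoffel (A : Charts ι M E) (τ : ι → E × E → Lip E E)
    (Γ : ι → E → Lip E (Lip E E)) : Prop :=
  ∀ i, ∀ f ∈ A.target i, ∀ g h : E, Γ i f g h = τ i (f, g) h

/-- The compatibility condition for Christoffel symbols on a manifold; here `i`, `j` are charts and
`Θ = φ_i ∘ φ_j⁻¹`. -/
def ChristoffelCompatible {M : Type v} [TopologicalSpace M] [ChartedSpace E M]
    (Γ : atlas E M → E → Lip E (Lip E E)) : Prop :=
  ∀ i j : atlas E M, ∀ f ∈ j.1 '' (i.1.source ∩ j.1.source), ∀ g h : E,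
    let Θ : E → E := i.1 ∘ j.1.symm
    Γ i (Θ f) (dirDeriv Θ f g) (dirDeriv Θ f h)
      + dirDeriv (fun x => dirDeriv Θ x g) f h = dirDeriv Θ f (Γ j f g h)

end Connections

end

/-! In a chart, `Ψ` becomes a smooth family of bijections `Ω_f` of `F × F`, with smooth inverses
`Λ_f`, sending the velocity and acceleration `(v, a)` of a 2-jet to coordinates in `TM ⊕ TM`. The
linear structure on `T²M` is arbitrary, so `Ω_f` need not be linear in `(v, a)`, nor vanish at the
zero jet. Only its derivatives at the zero jet are used.

Let `Θ` be a change of charts, `A = DΘ(f)`, `B = D²Θ(f)`. Jets change by the quadratic map `q(v, a)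
= (A v, B(v, v) + A a)`, and `TM ⊕ TM` changes by `P = A × A`, so `Ω' ∘ q = P ∘ Ω`. The first
derivative at `0` gives `DΩ' ∘ P = P ∘ DΩ`. The second derivative along `t ↦ (t v, 0)` gives `D²Ω'(A
v, A v) + DΩ'(0, 2 B(v, v)) = P D²Ω(v, v)`, where `D²Ω` is taken in velocity directions. Applying
`(DΩ')⁻¹` and halving the second component gives the Christoffel rule on the diagonal for `Γ = ½ pr₂
(DΩ)⁻¹ D²Ω` (`christoffel_change_diag`). All terms are symmetric, since second derivatives are, so
polarization gives the full rule (`christoffel_change`). That rule is exactly what makes `k + Γ(g,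
h)` independent of the chart (`exists_isLinearConnection`). If `Ω(v, a) = (L v, L a + b(v, v))`,
then `DΩ = L × L` and `D²Ω(v, v) = (0, 2 b(v, v))`, whence `L Γ = b` on the diagonal
(`map_christoffel`).

The calculus needs care because `𝓛(E, F)` is only a topological group: scalar multiplication need
not be jointly continuous and the norm is not homogeneous. The mean value inequality survives by
absolute convexity of balls and yields the chain rule and the symmetry of second derivatives. On
open sets, `MC^k` amounts to iterated b-differentiability with values in the full groups `𝓛`
(`isMC_iff_isBC`), where products and compositions are handled by bounded bilinear maps. -/

noncomputable section

set_option linter.unusedSectionVars false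

/-! ### The mean value inequality -/

section MeanValue

variable {G : Type*} [NormedAddCommGroup G] [Module ℝ G] [StandardMetric G]

/-- The slope over the union of two adjacent intervals is a convex combination of the two slopes, so
absolute convexity of balls preserves the bound. This replaces the additivity of length estimates,
which would need a homogeneous norm. -/
theorem StandardMetric.norm_slope_le_of_adjacent {γ : ℝ → G} {D a b c : ℝ} (hab : a < b)
    (hbc : b < c) (h₁ : ‖(b - a)⁻¹ • (γ b - γ a)‖ ≤ D) (h₂ : ‖(c - b)⁻¹ • (γ c - γ b)‖ ≤ D) :
    ‖(c - a)⁻¹ • (γ c - γ a)‖ ≤ D := by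
  have ha : (0 : ℝ) < b - a := sub_pos.2 hab
  have hb : (0 : ℝ) < c - b := sub_pos.2 hbc
  have hc : (0 : ℝ) < c - a := by linarith
  have e : (c - a)⁻¹ • (γ c - γ a) = ((b - a) / (c - a)) • ((b - a)⁻¹ • (γ b - γ a))
      + ((c - b) / (c - a)) • ((c - b)⁻¹ • (γ c - γ b)) := by
    rw [smul_smul, smul_smul]
    have e₁ : (b - a) / (c - a) * (b - a)⁻¹ = (c - a)⁻¹ := by field_simp
    have e₂ : (c - b) / (c - a) * (c - b)⁻¹ = (c - a)⁻¹ := by field_simp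
    rw [e₁, e₂, ← smul_add]
    congr 1
    abel
  rw [e]
  refine (StandardMetric.norm_comb_le ?_ _ _).trans (max_le h₁ h₂)
  rw [abs_of_pos (by positivity), abs_of_pos (by positivity), ← add_div, div_le_one hc]
  linarith

/-- A continuity argument along `[0, 1]`: for any `D > C`, the times up to which the slope from `0`
is bounded by `D` have a supremum that is attained and cannot be less than `1`. Every step glues
adjacent slopes, so continuity of scalar multiplication on `G` is never needed. -/
theorem StandardMetric.norm_sub_le_of_hasDirDeriv {γ γ' : ℝ → G} {C : ℝ}
    (hγ : ∀ t ∈ Icc (0 : ℝ) 1, HasDirDeriv γ t 1 (γ' t))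
    (hC : ∀ t ∈ Icc (0 : ℝ) 1, ‖γ' t‖ ≤ C) : ‖γ 1 - γ 0‖ ≤ C := by
  refine le_of_forall_gt_imp_ge_of_dense fun D hD => ?_
  have loc : ∀ t ∈ Icc (0 : ℝ) 1, ∃ δ > 0, ∀ s, s ≠ 0 → |s| < δ →
      ‖s⁻¹ • (γ (t + s) - γ t)‖ ≤ D := by
    intro t ht
    have h1 : ∀ᶠ y in 𝓝 (γ' t), ‖y‖ < D :=
      continuous_norm.continuousAt.eventually_lt continuousAt_const ((hC t ht).trans_lt hD)
    have h2 := (hγ t ht).eventually h1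
    rw [eventually_nhdsWithin_iff, Metric.eventually_nhds_iff] at h2
    obtain ⟨δ, hδ, h⟩ := h2
    refine ⟨δ, hδ, fun s hs hs' => ?_⟩
    simpa using (h (by simpa using hs') hs).le
  -- The alternative `t = 0` provides the starting point, where no slope is available.
  let S : Set ℝ := {t | t ∈ Icc (0 : ℝ) 1 ∧ (t = 0 ∨ ‖(t - 0)⁻¹ • (γ t - γ 0)‖ ≤ D)}
  have S0 : (0 : ℝ) ∈ S := ⟨by simp, Or.inl rfl⟩
  have Sbdd : BddAbove S := ⟨1, fun t ht => ht.1.2⟩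
  have step : ∀ a ∈ S, ∀ b, a < b → b ≤ 1 → ‖(b - a)⁻¹ • (γ b - γ a)‖ ≤ D → b ∈ S := by
    rintro a ⟨ha, ha'⟩ b hab hb h
    refine ⟨⟨ha.1.trans hab.le, hb⟩, Or.inr ?_⟩
    rcases ha' with rfl | ha'
    · exact h
    · rcases ha.1.eq_or_lt with rfl | h0
      · exact h
      · exact StandardMetric.norm_slope_le_of_adjacent h0 hab ha' h
  set σ := sSup S with hσ
  have hσ0 : 0 ≤ σ := le_csSup Sbdd S0
  have hσ1 : σ ≤ 1 := csSup_le ⟨0, S0⟩ fun t ht => ht.1.2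
  obtain ⟨δ, hδ, hloc⟩ := loc σ ⟨hσ0, hσ1⟩
  have hσS : σ ∈ S := by
    obtain ⟨a, haS, ha⟩ := exists_lt_of_lt_csSup ⟨0, S0⟩ (sub_lt_self σ hδ)
    have haσ : a ≤ σ := le_csSup Sbdd haS
    rcases haσ.eq_or_lt with h | h
    · exact h ▸ haS
    · refine step a haS σ h hσ1 ?_
      have := hloc (a - σ) (by linarith) (by rw [abs_of_neg (by linarith)]; linarith)
      rw [← neg_sub (γ a), smul_neg, ← neg_smul, ← inv_neg, neg_sub]
      simpa using this
  have h1 : σ = 1 := by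
    by_contra hne
    have hlt : σ < 1 := lt_of_le_of_ne hσ1 hne
    set s := min (δ / 2) (1 - σ) with hs
    have hs0 : 0 < s := lt_min (by linarith) (by linarith)
    have hsδ : s < δ := (min_le_left _ _).trans_lt (by linarith)
    have hs1 : s ≤ 1 - σ := min_le_right _ _
    have := step σ hσS (σ + s) (by linarith) (by linarith)
      (by simpa using hloc s hs0.ne' (by rwa [abs_of_pos hs0]))
    have := le_csSup Sbdd this
    linarith
  rw [h1] at hσS
  simpa using hσS.2

end MeanValue

/-! ### Operations on Lipschitz linear maps -/

namespace Lip

variable {E : Type*} [NormedAddCommGroup E] [Module ℝ E]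
variable {G : Type*} [NormedAddCommGroup G] [Module ℝ G] [StandardMetric G]
variable {G₁ : Type*} [NormedAddCommGroup G₁] [Module ℝ G₁] [StandardMetric G₁]
variable {G₂ : Type*} [NormedAddCommGroup G₂] [Module ℝ G₂] [StandardMetric G₂]
variable {G₃ : Type*} [NormedAddCommGroup G₃] [Module ℝ G₃] [StandardMetric G₃]

theorem norm_apply_le (L : Lip E G) (x : E) : ‖L x‖ ≤ ‖L‖ * ‖x‖ := L.le_opNorm x

theorem norm_le_of_bound (L : Lip E G) {C : ℝ} (hC : 0 ≤ C) (h : ∀ x, ‖L x‖ ≤ C * ‖x‖) :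
    ‖L‖ ≤ C := L.opNorm_le hC h

@[simp] theorem add_apply (L H : Lip E G) (x : E) : (L + H) x = L x + H x := rfl
@[simp] theorem sub_apply (L H : Lip E G) (x : E) : (L - H) x = L x - H x := rfl
@[simp] theorem smul_apply (c : ℝ) (L : Lip E G) (x : E) : (c • L) x = c • L x := rfl

theorem ext' {L H : Lip E G} (h : ∀ x, L x = H x) : L = H :=
  Subtype.ext (LinearMap.ext h)

theorem continuous (L : Lip E G) : Continuous fun x => L x :=
  AddMonoidHomClass.continuous_of_bound (L.1 : E →ₗ[ℝ] G) ‖L‖ L.norm_apply_le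

/-- Composition. -/
def comp (L : Lip G₁ G₂) (H : Lip E G₁) : Lip E G₂ :=
  ⟨L.1 ∘ₗ H.1, ‖L‖ * ‖H‖, fun x => (L.norm_apply_le _).trans (by
    rw [mul_assoc]
    exact mul_le_mul_of_nonneg_left (H.norm_apply_le x) (norm_nonneg _))⟩

@[simp] theorem comp_apply (L : Lip G₁ G₂) (H : Lip E G₁) (x : E) : L.comp H x = L (H x) := rfl

theorem norm_comp_le (L : Lip G₁ G₂) (H : Lip E G₁) : ‖L.comp H‖ ≤ ‖L‖ * ‖H‖ :=
  norm_le_of_bound _ (by positivity) fun x => (L.norm_apply_le _).trans (by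
    rw [mul_assoc]
    exact mul_le_mul_of_nonneg_left (H.norm_apply_le x) (norm_nonneg _))

/-- A bounded bilinear map as an iterated Lipschitz linear map. -/
def mkBilin (f : E →ₗ[ℝ] G₂ →ₗ[ℝ] G₃) (C : ℝ) (hC : 0 ≤ C)
    (h : ∀ a b, ‖f a b‖ ≤ C * ‖a‖ * ‖b‖) : Lip E (Lip G₂ G₃) :=
  ⟨{ toFun := fun a => ⟨f a, C * ‖a‖, h a⟩
     map_add' := fun a b => ext' fun x => by
      change f (a + b) x = f a x + f b x
      simp
     map_smul' := fun c a => ext' fun x => by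
      change f (c • a) x = c • f a x
      simp },
    C, fun a => norm_le_of_bound _ (by positivity) (h a)⟩

theorem norm_apply_apply_le (β : Lip E (Lip G₂ G₃)) (a : E) (b : G₂) :
    ‖β a b‖ ≤ ‖β‖ * ‖a‖ * ‖b‖ :=
  ((β a).norm_apply_le b).trans
    (mul_le_mul_of_nonneg_right (β.norm_apply_le a) (norm_nonneg _))

@[simp] theorem map_add (L : Lip E G) (x y : E) : L (x + y) = L x + L y := L.1.map_add x y
@[simp] theorem map_sub (L : Lip E G) (x y : E) : L (x - y) = L x - L y := L.1.map_sub x y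
@[simp] theorem map_smul (L : Lip E G) (c : ℝ) (x : E) : L (c • x) = c • L x := L.1.map_smul c x
@[simp] theorem map_zero (L : Lip E G) : L 0 = 0 := L.1.map_zero

/-- Exchange of the arguments of a bounded bilinear map. -/
def flip (β : Lip G₁ (Lip G₂ G₃)) : Lip G₂ (Lip G₁ G₃) :=
  mkBilin (LinearMap.mk₂ ℝ (fun b a => β a b) (by simp) (by simp) (by simp) (by simp))
    ‖β‖ (norm_nonneg _) fun b a => by
      simpa [mul_right_comm] using β.norm_apply_apply_le a b

variable (E G₁ G₂) in
/-- Composition as a bounded bilinear map. -/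
def compL : Lip (Lip G₁ G₂) (Lip (Lip E G₁) (Lip E G₂)) :=
  mkBilin (LinearMap.mk₂ ℝ (fun L H => comp L H) (fun _ _ _ => rfl) (fun _ _ _ => rfl)
    (fun L _ _ => ext' fun _ => by simp) (fun _ L _ => ext' fun _ => by simp))
    1 zero_le_one fun L H => by rw [one_mul]; exact norm_comp_le L H

/-- The identity. -/
def id (G : Type*) [NormedAddCommGroup G] [Module ℝ G] [StandardMetric G] : Lip G G :=
  ⟨LinearMap.id, 1, fun x => by simp⟩

@[simp] theorem id_apply (x : G) : Lip.id G x = x := rfl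

variable (G₁ G₂) in
/-- The first projection. -/
def fst : Lip (G₁ × G₂) G₁ := ⟨LinearMap.fst ℝ G₁ G₂, 1, fun x => by simpa using norm_fst_le x⟩

variable (G₁ G₂) in
/-- The second projection. -/
def snd : Lip (G₁ × G₂) G₂ := ⟨LinearMap.snd ℝ G₁ G₂, 1, fun x => by simpa using norm_snd_le x⟩

variable (G₁ G₂) in
/-- The first inclusion. -/
def inl : Lip G₁ (G₁ × G₂) := ⟨LinearMap.inl ℝ G₁ G₂, 1, fun x => by simp [Prod.norm_def]⟩

variable (G₁ G₂) in
/-- The second inclusion. -/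
def inr : Lip G₂ (G₁ × G₂) := ⟨LinearMap.inr ℝ G₁ G₂, 1, fun x => by simp [Prod.norm_def]⟩

@[simp] theorem fst_apply (x : G₁ × G₂) : fst G₁ G₂ x = x.1 := rfl
@[simp] theorem snd_apply (x : G₁ × G₂) : snd G₁ G₂ x = x.2 := rfl
@[simp] theorem inl_apply (x : G₁) : inl G₁ G₂ x = (x, 0) := rfl
@[simp] theorem inr_apply (x : G₂) : inr G₁ G₂ x = (0, x) := rfl

/-- Splitting the increment as `β (a y - a x) (b y) + β (a x) (b y - b x)` uses only the bound on
`β` and continuity of `β (a x)`. -/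
theorem continuousOn_bilin {X : Type*} [TopologicalSpace X] {S : Set X} (β : Lip G₁ (Lip G₂ G₃))
    {a : X → G₁} {b : X → G₂} (ha : ContinuousOn a S) (hb : ContinuousOn b S) :
    ContinuousOn (fun x => β (a x) (b x)) S := by
  intro x hx
  have h1 : Tendsto (fun y => β (a y - a x) (b y)) (𝓝[S] x) (𝓝 0) := by
    have h : Tendsto (fun y => ‖β‖ * ‖a y - a x‖ * ‖b y‖) (𝓝[S] x) (𝓝 0) := by
      have := (((ha x hx).sub_const (a x)).norm.const_mul ‖β‖).mul (hb x hx).norm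
      simpa using this
    exact squeeze_zero_norm (fun y => β.norm_apply_apply_le _ _) h
  have h2 : Tendsto (fun y => β (a x) (b y)) (𝓝[S] x) (𝓝 (β (a x) (b x))) :=
    ((β (a x)).continuous.tendsto _).comp (hb x hx)
  have := h1.add h2
  simp only [zero_add] at this
  refine this.congr fun y => ?_
  simp

end Lip

/-! ### Directional derivatives -/

section DirDeriv

variable {E₀ : Type*} [AddCommGroup E₀] [Module ℝ E₀]
variable {E : Type*} [NormedAddCommGroup E] [Module ℝ E]
variable {G : Type*} [NormedAddCommGroup G] [Module ℝ G]
variable {G₁ : Type*} [NormedAddCommGroup G₁] [Module ℝ G₁] [StandardMetric G₁]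
variable {G₂ : Type*} [NormedAddCommGroup G₂] [Module ℝ G₂] [StandardMetric G₂]

theorem HasDirDeriv.unique {P : E₀ → G} {p h : E₀} {y z : G} (hy : HasDirDeriv P p h y)
    (hz : HasDirDeriv P p h z) : y = z :=
  tendsto_nhds_unique hy hz

theorem HasDirDeriv.dirDeriv_eq {P : E₀ → G} {p h : E₀} {y : G} (hy : HasDirDeriv P p h y) :
    dirDeriv P p h = y :=
  hy.limUnder_eq

theorem hasDirDeriv_const (a : G) (p h : E₀) : HasDirDeriv (fun _ => a) p h 0 := by
  simp [HasDirDeriv]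

theorem HasDirDeriv.add {P Q : E₀ → G} {p h : E₀} {y z : G} (hy : HasDirDeriv P p h y)
    (hz : HasDirDeriv Q p h z) : HasDirDeriv (fun x => P x + Q x) p h (y + z) := by
  refine (Tendsto.add hy hz).congr fun t => ?_
  rw [← smul_add, add_sub_add_comm]

theorem HasDirDeriv.neg {P : E₀ → G} {p h : E₀} {y : G} (hy : HasDirDeriv P p h y) :
    HasDirDeriv (fun x => -P x) p h (-y) := by
  refine (Tendsto.neg hy).congr fun t => ?_
  rw [← smul_neg, neg_sub, neg_sub_neg]

theorem HasDirDeriv.sub {P Q : E₀ → G} {p h : E₀} {y z : G} (hy : HasDirDeriv P p h y)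
    (hz : HasDirDeriv Q p h z) : HasDirDeriv (fun x => P x - Q x) p h (y - z) := by
  simpa [sub_eq_add_neg] using hy.add hz.neg

theorem HasDirDeriv.prodMk {P : E₀ → G} {Q : E₀ → G₁} {p h : E₀} {y : G} {z : G₁}
    (hy : HasDirDeriv P p h y) (hz : HasDirDeriv Q p h z) :
    HasDirDeriv (fun x => (P x, Q x)) p h (y, z) :=
  Tendsto.prodMk_nhds hy hz

theorem Lip.hasDirDeriv (L : Lip E G₂) (p h : E) : HasDirDeriv (fun x => L x) p h (L h) := by
  refine tendsto_const_nhds.congr' ?_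
  filter_upwards [self_mem_nhdsWithin] with t ht
  rw [← L.map_sub, ← L.map_smul, add_sub_cancel_left, smul_smul, inv_mul_cancel₀ ht, one_smul]

theorem HasDirDeriv.lip_comp (L : Lip G₁ G₂) {P : E₀ → G₁} {p h : E₀} {y : G₁}
    (hy : HasDirDeriv P p h y) : HasDirDeriv (fun x => L (P x)) p h (L y) := by
  refine ((L.continuous.tendsto y).comp hy).congr fun t => ?_
  simp

theorem HasDirDeriv.congr {P Q : E₀ → G} {p h : E₀} {y : G} (hy : HasDirDeriv P p h y)
    (h0 : P p = Q p) (hPQ : ∀ᶠ t in 𝓝[≠] (0 : ℝ), P (p + t • h) = Q (p + t • h)) :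
    HasDirDeriv Q p h y := by
  refine Tendsto.congr' ?_ hy
  filter_upwards [hPQ] with t ht
  rw [ht, h0]

theorem tendsto_add_smul [ContinuousSMul ℝ E] (p h : E) :
    Tendsto (fun t : ℝ => p + t • h) (𝓝[≠] 0) (𝓝 p) := by
  have : Continuous fun t : ℝ => p + t • h := by fun_prop
  simpa using (this.tendsto 0).mono_left nhdsWithin_le_nhds

theorem HasDirDeriv.congr_of_eventuallyEq [ContinuousSMul ℝ E] {P Q : E → G} {p h : E} {y : G}
    (hy : HasDirDeriv P p h y) (hPQ : P =ᶠ[𝓝 p] Q) : HasDirDeriv Q p h y :=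
  hy.congr hPQ.eq_of_nhds ((tendsto_add_smul p h).eventually hPQ)

/-- The Leibniz rule for bounded bilinear maps. -/
theorem HasDirDeriv.bilin {G₃ : Type*} [NormedAddCommGroup G₃] [Module ℝ G₃] [StandardMetric G₃]
    (β : Lip G₁ (Lip G₂ G₃)) {a : E₀ → G₁} {b : E₀ → G₂} {p h : E₀} {a' : G₁} {b' : G₂}
    (ha : HasDirDeriv a p h a') (hb : HasDirDeriv b p h b')
    (hc : Tendsto (fun t : ℝ => b (p + t • h)) (𝓝[≠] 0) (𝓝 (b p))) :
    HasDirDeriv (fun x => β (a x) (b x)) p h (β a' (b p) + β (a p) b') := by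
  -- The second factor is evaluated at the moved point, which is where `hc` enters. It does not
  -- follow from `hb`: in a group such as `𝓛` the curve `t ↦ t • L` has slopes `L` but need not be
  -- continuous at `0`.
  have h1 : Tendsto (fun t : ℝ => β (t⁻¹ • (a (p + t • h) - a p)) (b (p + t • h)))
      (𝓝[≠] 0) (𝓝 (β a' (b p))) := by
    have e : Tendsto (fun z : G₁ × G₂ => β z.1 z.2) (𝓝 (a', b p)) (𝓝 (β a' (b p))) :=
      ((Lip.continuousOn_bilin β continuousOn_fst continuousOn_snd :
        ContinuousOn (fun z : G₁ × G₂ => β z.1 z.2) univ).continuousAt univ_mem).tendsto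
    exact e.comp (Tendsto.prodMk_nhds ha hc)
  have h2 : Tendsto (fun t : ℝ => β (a p) (t⁻¹ • (b (p + t • h) - b p)))
      (𝓝[≠] 0) (𝓝 (β (a p) b')) := ((β (a p)).continuous.tendsto _).comp hb
  refine (h1.add h2).congr fun t => ?_
  simp only [Lip.map_smul, Lip.map_sub, Lip.smul_apply, Lip.sub_apply]
  rw [← smul_add]
  congr 1
  abel

end DirDeriv

/-! ### The chain rule -/

section Chain

variable {E₀ : Type*} [AddCommGroup E₀] [Module ℝ E₀]
variable {E : Type u} [NormedAddCommGroup E] [Module ℝ E]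
variable {G : Type u} [NormedAddCommGroup G] [Module ℝ G] [StandardMetric G]

/-- The factor `t⁻¹` is placed inside the curve before the mean value inequality is applied, since a
non-homogeneous norm would not allow dividing the estimate by `t` afterwards. -/
theorem HasDirDeriv.norm_slope_sub_le {P : E → G} {P' : E → Lip E G} {x k : E} {t C : ℝ}
    (ht : t ≠ 0) (w : G) (h : ∀ s ∈ Icc (0 : ℝ) 1,
      HasDirDeriv P (x + (s * t) • k) k (P' (x + (s * t) • k) k) ∧
        ‖P' (x + (s * t) • k) k - w‖ ≤ C) :
    ‖t⁻¹ • (P (x + t • k) - P x) - w‖ ≤ C := by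
  have key := StandardMetric.norm_sub_le_of_hasDirDeriv
    (γ := fun s : ℝ => t⁻¹ • P (x + (s * t) • k) - s • w)
    (γ' := fun s => P' (x + (s * t) • k) k - w) (C := C) ?_ fun s hs => (h s hs).2
  · simpa [smul_sub, sub_right_comm] using key
  · intro s hs
    have h1 := (h s hs).1
    have h2 : Tendsto (fun r : ℝ => r * t) (𝓝[≠] 0) (𝓝[≠] 0) := by
      refine tendsto_nhdsWithin_iff.2 ⟨?_, ?_⟩
      · have : Continuous fun r : ℝ => r * t := by fun_prop
        simpa using (this.tendsto 0).mono_left nhdsWithin_le_nhds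
      · filter_upwards [self_mem_nhdsWithin] with r hr
        exact mul_ne_zero hr ht
    have h3 := (h1.comp h2).sub_const w
    refine h3.congr' ?_
    filter_upwards [self_mem_nhdsWithin] with r hr
    have hr : r ≠ 0 := hr
    simp only [Function.comp, smul_eq_mul, mul_one, add_smul, add_mul]
    rw [mul_inv, ← add_assoc, mul_smul, add_sub_add_comm_aux, smul_sub t⁻¹,
      smul_sub r⁻¹ _ (r • _), smul_smul r⁻¹ r, inv_mul_cancel₀ hr, one_smul]
where
  add_sub_add_comm_aux {A B c d : G} : A - (c + d) - (B - c) = (A - B) - d := by abel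

theorem IsBDiff.norm_slope_sub_le {P : E → G} {P' : E → Lip E G} {U : Set E}
    (hP : IsBDiff P P' U) {x k : E} {t ε : ℝ} (ht : t ≠ 0) (L : Lip E G)
    (h : ∀ s ∈ Icc (0 : ℝ) 1, x + (s * t) • k ∈ U ∧ ‖P' (x + (s * t) • k) - L‖ ≤ ε) :
    ‖t⁻¹ • (P (x + t • k) - P x) - L k‖ ≤ ε * ‖k‖ :=
  HasDirDeriv.norm_slope_sub_le ht _ fun s hs => ⟨hP.hasDirDeriv _ (h s hs).1 k,
    ((P' (x + (s * t) • k) - L).norm_apply_le k).trans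
      (mul_le_mul_of_nonneg_right (h s hs).2 (norm_nonneg _))⟩

/-- Writing `c (p + t • h) = c p + t • k t` with `k t → y`, the mean value inequality compares the
slope of `P` with `P' (c p) (k t)` rather than `P' (c p) y`; the latter is then reached by
continuity of the linear map. -/
theorem IsBDiff.comp_hasDirDeriv [StandardMetric E] [ContinuousSMul ℝ E] {P : E → G}
    {P' : E → Lip E G} {U : Set E} (hP : IsBDiff P P' U) (hU : IsOpen U) {c : E₀ → E} {p h : E₀}
    {y : E} (hc : HasDirDeriv c p h y) (hp : c p ∈ U) :
    HasDirDeriv (fun x => P (c x)) p h (P' (c p) y) := by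
  set k : ℝ → E := fun t => t⁻¹ • (c (p + t • h) - c p) with hk
  have hk' : Tendsto k (𝓝[≠] 0) (𝓝 y) := hc
  have htk : Tendsto (fun t => t • k t) (𝓝[≠] 0) (𝓝 0) := by
    have h0 : Tendsto (fun t : ℝ => t) (𝓝[≠] 0) (𝓝 0) := nhdsWithin_le_nhds
    simpa using h0.smul hk'
  have hcont : ContinuousAt P' (c p) := hP.continuousOn_deriv.continuousAt (hU.mem_nhds hp)
  have hLk : Tendsto (fun t => P' (c p) (k t)) (𝓝[≠] 0) (𝓝 (P' (c p) y)) :=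
    ((P' (c p)).continuous.tendsto _).comp hk'
  suffices hs : Tendsto (fun t : ℝ => t⁻¹ • (P (c (p + t • h)) - P (c p)) - P' (c p) (k t))
      (𝓝[≠] 0) (𝓝 0) by
    have := hs.add hLk
    simpa [HasDirDeriv] using this
  rw [Metric.tendsto_nhds]
  intro ε hε
  -- The final error is at most `η * ‖k t‖`, and eventually `‖k t‖ < ‖y‖ + 1`, so this `η` leaves `ε
  -- / 2`.
  set η := ε / (‖y‖ + 1) / 2 with hη
  have hη0 : 0 < η := by positivity
  have hball : ∀ᶠ z in 𝓝 (c p), z ∈ U ∧ ‖P' z - P' (c p)‖ ≤ η := by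
    filter_upwards [hU.mem_nhds hp, Metric.tendsto_nhds.1 hcont η hη0] with z hz hz'
    exact ⟨hz, by rw [← dist_eq_norm]; exact hz'.le⟩
  obtain ⟨δ, hδ, hδ'⟩ := Metric.eventually_nhds_iff.1 hball
  have e1 : ∀ᶠ t in 𝓝[≠] (0 : ℝ), ‖t • k t‖ < δ := by
    have := Metric.tendsto_nhds.1 htk δ hδ
    simpa using this
  have e2 : ∀ᶠ t in 𝓝[≠] (0 : ℝ), ‖k t‖ < ‖y‖ + 1 :=
    hk'.norm.eventually_lt_const (by linarith)
  filter_upwards [e1, e2, self_mem_nhdsWithin] with t h1 h2 ht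
  have ht : t ≠ 0 := ht
  have hct : c (p + t • h) = c p + t • k t := by
    simp [hk, smul_smul, mul_inv_cancel₀ ht]
  rw [hct, dist_zero_right]
  refine (hP.norm_slope_sub_le ht (P' (c p)) (ε := η) fun s hs => ?_).trans_lt ?_
  · refine hδ' ?_
    rw [dist_eq_norm, add_sub_cancel_left, mul_smul]
    exact (StandardMetric.norm_smul_le (by rw [abs_of_nonneg hs.1]; exact hs.2) _).trans_lt h1
  · calc η * ‖k t‖ ≤ η * (‖y‖ + 1) := by gcongr
      _ = ε / 2 := by rw [hη]; field_simp
      _ < ε := by linarith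

variable {G₁ : Type u} [NormedAddCommGroup G₁] [Module ℝ G₁] [StandardMetric G₁]
  [ContinuousSMul ℝ G₁]

theorem IsBDiff.comp {P : G₁ → G} {P' : G₁ → Lip G₁ G} {U : Set G₁} (hP : IsBDiff P P' U)
    (hU : IsOpen U) {Q : E → G₁} {Q' : E → Lip E G₁} {V : Set E} (hQ : IsBDiff Q Q' V)
    (hm : MapsTo Q V U) :
    IsBDiff (fun x => P (Q x)) (fun x => (P' (Q x)).comp (Q' x)) V where
  continuousOn := hP.continuousOn.comp hQ.continuousOn hm
  hasDirDeriv p hp h := hP.comp_hasDirDeriv hU (hQ.hasDirDeriv p hp h) (hm hp)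
  continuousOn_deriv := Lip.continuousOn_bilin (Lip.compL E G₁ G)
    (hP.continuousOn_deriv.comp hQ.continuousOn hm) hQ.continuousOn_deriv

variable {G₂ : Type u} [NormedAddCommGroup G₂] [Module ℝ G₂] [StandardMetric G₂]
variable {G₃ : Type u} [NormedAddCommGroup G₃] [Module ℝ G₃] [StandardMetric G₃]

theorem IsBDiff.mono {P : E → G} {P' : E → Lip E G} {U V : Set E} (h : IsBDiff P P' U)
    (hV : V ⊆ U) : IsBDiff P P' V :=
  ⟨h.continuousOn.mono hV, fun p hp => h.hasDirDeriv p (hV hp), h.continuousOn_deriv.mono hV⟩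

theorem IsBDiff.congr [ContinuousSMul ℝ E] {P Q : E → G} {P' Q' : E → Lip E G} {U : Set E}
    (h : IsBDiff P P' U) (hU : IsOpen U) (hPQ : EqOn P Q U) (hPQ' : EqOn P' Q' U) :
    IsBDiff Q Q' U where
  continuousOn := h.continuousOn.congr hPQ.symm
  hasDirDeriv p hp k := by
    rw [← hPQ' hp]
    exact (h.hasDirDeriv p hp k).congr_of_eventuallyEq (hPQ.eventuallyEq_of_mem (hU.mem_nhds hp))
  continuousOn_deriv := h.continuousOn_deriv.congr hPQ'.symm

theorem IsBDiff.lip_comp (L : Lip G G₂) {P : E → G} {P' : E → Lip E G} {U : Set E}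
    (h : IsBDiff P P' U) : IsBDiff (fun x => L (P x)) (fun x => L.comp (P' x)) U where
  continuousOn := L.continuous.comp_continuousOn h.continuousOn
  hasDirDeriv p hp k := (h.hasDirDeriv p hp k).lip_comp L
  continuousOn_deriv := (Lip.compL E G G₂ L).continuous.comp_continuousOn h.continuousOn_deriv

theorem IsBDiff.bilin [ContinuousSMul ℝ E] {G₁ : Type u} [NormedAddCommGroup G₁] [Module ℝ G₁]
    [StandardMetric G₁] (β : Lip G₁ (Lip G₂ G₃)) {a : E → G₁} {a' : E → Lip E G₁}
    {b : E → G₂} {b' : E → Lip E G₂} {U : Set E} (hU : IsOpen U) (ha : IsBDiff a a' U)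
    (hb : IsBDiff b b' U) :
    IsBDiff (fun x => β (a x) (b x))
      (fun x => ((Lip.compL E G₁ G₃).comp β.flip).flip (a' x) (b x)
        + (Lip.compL E G₂ G₃).comp β (a x) (b' x)) U where
  continuousOn := Lip.continuousOn_bilin β ha.continuousOn hb.continuousOn
  hasDirDeriv p hp h := by
    refine HasDirDeriv.bilin β (ha.hasDirDeriv p hp h) (hb.hasDirDeriv p hp h) ?_
    exact (hb.continuousOn.continuousAt (hU.mem_nhds hp)).tendsto.comp (tendsto_add_smul p h)
  continuousOn_deriv :=
    (Lip.continuousOn_bilin _ ha.continuousOn_deriv hb.continuousOn).add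
      (Lip.continuousOn_bilin _ ha.continuousOn hb.continuousOn_deriv)

end Chain

/-! ### Higher b-differentiability -/

section BDeriv

variable {E : Type u} [NormedAddCommGroup E] [Module ℝ E]
variable {G : Type u} [NormedAddCommGroup G] [Module ℝ G] [StandardMetric G]

open Classical in
/-- The derivative of `P` at `x` as a Lipschitz linear map, if it exists. -/
def bderiv (P : E → G) (x : E) : Lip E G :=
  if h : ∃ L : Lip E G, ∀ k, HasDirDeriv P x k (L k) then h.choose else 0

theorem bderiv_eq {P : E → G} {x : E} {L : Lip E G} (h : ∀ k, HasDirDeriv P x k (L k)) :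
    bderiv P x = L := by
  have h' : ∃ L : Lip E G, ∀ k, HasDirDeriv P x k (L k) := ⟨L, h⟩
  rw [bderiv, dif_pos h']
  exact Lip.ext' fun k => (h'.choose_spec k).unique (h k)

theorem IsBDiff.bderiv_eq {P : E → G} {P' : E → Lip E G} {U : Set E} (h : IsBDiff P P' U)
    {x : E} (hx : x ∈ U) : bderiv P x = P' x :=
  _root_.bderiv_eq (h.hasDirDeriv x hx)

/-- `P` is `k` times b-differentiable on `U`, the derivatives being regarded as maps into the
groups of Lipschitz linear maps. -/
def IsBC : ℕ → ∀ {G : Type u} [NormedAddCommGroup G] [Module ℝ G] [StandardMetric G],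
    (E → G) → Set E → Prop
  | 0, _, _, _, _, P, U => ContinuousOn P U
  | k + 1, G, _, _, _, P, U => ∃ P' : E → Lip E G, IsBDiff P P' U ∧ IsBC k P' U

namespace IsBC

variable {G₁ : Type u} [NormedAddCommGroup G₁] [Module ℝ G₁] [StandardMetric G₁]
variable {G₂ : Type u} [NormedAddCommGroup G₂] [Module ℝ G₂] [StandardMetric G₂]
variable {G₃ : Type u} [NormedAddCommGroup G₃] [Module ℝ G₃] [StandardMetric G₃]

theorem continuousOn {k : ℕ} {P : E → G} {U : Set E} (h : IsBC k P U) : ContinuousOn P U := by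
  cases k with
  | zero => exact h
  | succ k => exact h.choose_spec.1.continuousOn

theorem mono {k : ℕ} {P : E → G} {U V : Set E} (h : IsBC k P U) (hV : V ⊆ U) : IsBC k P V := by
  induction k generalizing G with
  | zero => exact ContinuousOn.mono h hV
  | succ k ih =>
    obtain ⟨P', h1, h2⟩ := h
    exact ⟨P', h1.mono hV, ih h2⟩

theorem of_succ {k : ℕ} {P : E → G} {U : Set E} (h : IsBC (k + 1) P U) : IsBC k P U := by
  induction k generalizing G with
  | zero => exact h.continuousOn
  | succ k ih =>
    obtain ⟨P', h1, h2⟩ := h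
    exact ⟨P', h1, ih h2⟩

theorem congr [ContinuousSMul ℝ E] {k : ℕ} {P Q : E → G} {U : Set E} (h : IsBC k P U)
    (hU : IsOpen U) (hPQ : EqOn P Q U) : IsBC k Q U := by
  cases k with
  | zero => exact ContinuousOn.congr h hPQ.symm
  | succ k =>
    obtain ⟨P', h1, h2⟩ := h
    exact ⟨P', h1.congr hU hPQ fun _ _ => rfl, h2⟩

theorem const (k : ℕ) (a : G) (U : Set E) : IsBC k (fun _ => a) U := by
  induction k generalizing G with
  | zero => exact continuousOn_const
  | succ k ih =>
    exact ⟨fun _ => 0, ⟨continuousOn_const, fun p _ h => hasDirDeriv_const a p h,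
      continuousOn_const⟩, ih 0⟩

theorem lip (k : ℕ) (L : Lip E G) (U : Set E) : IsBC k (fun x => L x) U := by
  cases k with
  | zero => exact L.continuous.continuousOn
  | succ k =>
    exact ⟨fun _ => L, ⟨L.continuous.continuousOn, fun p _ h => L.hasDirDeriv p h,
      continuousOn_const⟩, const k L U⟩

theorem lip_comp {k : ℕ} (L : Lip G G₁) {P : E → G} {U : Set E} (h : IsBC k P U) :
    IsBC k (fun x => L (P x)) U := by
  induction k generalizing G G₁ with
  | zero => exact L.continuous.comp_continuousOn h
  | succ k ih =>
    obtain ⟨P', h1, h2⟩ := h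
    exact ⟨_, h1.lip_comp L, ih (Lip.compL E G G₁ L) h2⟩

theorem add {k : ℕ} {P Q : E → G} {U : Set E} (hP : IsBC k P U) (hQ : IsBC k Q U) :
    IsBC k (fun x => P x + Q x) U := by
  induction k generalizing G with
  | zero => exact ContinuousOn.add hP hQ
  | succ k ih =>
    obtain ⟨P', h1, h2⟩ := hP
    obtain ⟨Q', h3, h4⟩ := hQ
    exact ⟨fun x => P' x + Q' x, ⟨h1.continuousOn.add h3.continuousOn,
      fun p hp h => (h1.hasDirDeriv p hp h).add (h3.hasDirDeriv p hp h),
      h1.continuousOn_deriv.add h3.continuousOn_deriv⟩, ih h2 h4⟩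

theorem prodMk {k : ℕ} {P : E → G} {Q : E → G₁} {U : Set E} (hP : IsBC k P U)
    (hQ : IsBC k Q U) : IsBC k (fun x => (P x, Q x)) U := by
  simpa using (hP.lip_comp (Lip.inl G G₁)).add (hQ.lip_comp (Lip.inr G G₁))

/-- The Leibniz derivative is a sum of two bounded bilinear expressions, in `(a', b)` and `(a, b')`,
so the induction has to vary the bilinear map and the spaces as well. -/
theorem bilin [ContinuousSMul ℝ E] {k : ℕ} (β : Lip G₁ (Lip G₂ G₃)) {a : E → G₁} {b : E → G₂}
    {U : Set E} (hU : IsOpen U) (ha : IsBC k a U) (hb : IsBC k b U) :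
    IsBC k (fun x => β (a x) (b x)) U := by
  induction k generalizing G₁ G₂ G₃ with
  | zero => exact Lip.continuousOn_bilin β ha hb
  | succ k ih =>
    obtain ⟨a', h1, h2⟩ := id ha
    obtain ⟨b', h3, h4⟩ := id hb
    exact ⟨_, h1.bilin β hU h3, (ih _ h2 hb.of_succ).add (ih _ ha.of_succ h4)⟩

theorem comp [ContinuousSMul ℝ E] [ContinuousSMul ℝ G₁] {k : ℕ} {P : G₁ → G} {U : Set G₁}
    {Q : E → G₁} {V : Set E} (hP : IsBC k P U) (hU : IsOpen U) (hQ : IsBC k Q V)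
    (hV : IsOpen V) (hm : MapsTo Q V U) : IsBC k (fun x => P (Q x)) V := by
  induction k generalizing G with
  | zero => exact ContinuousOn.comp hP hQ hm
  | succ k ih =>
    obtain ⟨P', h1, h2⟩ := hP
    obtain ⟨Q', h3, h4⟩ := id hQ
    exact ⟨_, h1.comp hU h3 hm, bilin (Lip.compL E G₁ G) hV (ih h2 hQ.of_succ) h4⟩

/-- Derivatives chosen on different neighbourhoods are glued by replacing each with the canonical
`bderiv P`, which agrees with all of them by uniqueness of directional derivatives. -/
theorem of_locally [ContinuousSMul ℝ E] {k : ℕ} {P : E → G} {U : Set E}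
    (h : ∀ x ∈ U, ∃ V, IsOpen V ∧ x ∈ V ∧ IsBC k P V) : IsBC k P U := by
  induction k generalizing G with
  | zero =>
    intro x hx
    obtain ⟨V, hV, hxV, hPV⟩ := h x hx
    exact (ContinuousOn.continuousAt hPV (hV.mem_nhds hxV)).continuousWithinAt
  | succ k ih =>
    have key : ∀ x ∈ U, ∃ V, IsOpen V ∧ x ∈ V ∧ IsBDiff P (bderiv P) V ∧
        IsBC k (bderiv P) V := by
      intro x hx
      obtain ⟨V, hV, hxV, P', h1, h2⟩ := h x hx
      have e : EqOn P' (bderiv P) V := fun y hy => (h1.bderiv_eq hy).symm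
      exact ⟨V, hV, hxV, h1.congr hV (fun _ _ => rfl) e, h2.congr hV e⟩
    refine ⟨bderiv P, ⟨?_, ?_, ?_⟩, ih fun x hx => ?_⟩
    · intro x hx
      obtain ⟨V, hV, hxV, h1, h2⟩ := key x hx
      exact (h1.continuousOn.continuousAt (hV.mem_nhds hxV)).continuousWithinAt
    · intro x hx
      obtain ⟨V, hV, hxV, h1, h2⟩ := key x hx
      exact h1.hasDirDeriv x hxV
    · intro x hx
      obtain ⟨V, hV, hxV, h1, h2⟩ := key x hx
      exact (h2.continuousOn.continuousAt (hV.mem_nhds hxV)).continuousWithinAt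
    · obtain ⟨V, hV, hxV, h1, h2⟩ := key x hx
      exact ⟨V, hV, hxV, h2⟩

end IsBC

end BDeriv

/-! ### Comparison with `MC^k` maps -/

section Comparison

variable {E : Type u} [NormedAddCommGroup E] [Module ℝ E]

theorem StandardMetric.isConnected_ball [StandardMetric E] [ContinuousSMul ℝ E] (x : E) {r : ℝ}
    (hr : 0 < r) : IsConnected (Metric.ball x r) := by
  have h : IsConnected (Metric.ball (0 : E) r) :=
    ⟨⟨0, by simpa using hr⟩, (StandardMetric.absConvex_ball r).2.isPreconnected⟩
  have e : Metric.ball x r = (fun y => x + y) '' Metric.ball 0 r := by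
    ext y
    refine ⟨fun hy => ⟨y - x, by simpa [dist_eq_norm] using hy, by simp⟩, ?_⟩
    rintro ⟨z, hz, rfl⟩
    simpa [dist_eq_norm] using hz
  rw [e]
  exact h.image _ (by fun_prop)

variable {E₁ : Type u} [NormedAddCommGroup E₁] [Module ℝ E₁]
variable {E₂ : Type u} [NormedAddCommGroup E₂] [Module ℝ E₂] [StandardMetric E₂]

theorem mem_lipZero_of_isPreconnected {S : Set (Lip E₁ E₂)} (hS : IsPreconnected S)
    (h0 : (0 : Lip E₁ E₂) ∈ S) {L : Lip E₁ E₂} (hL : L ∈ S) : L ∈ LipZero E₁ E₂ :=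
  hS.subset_connectedComponent h0 hL

/-- The range is a continuous image of the convex, hence connected, space `E` and contains `0`.
Derivatives of maps into `𝓛(E₁, E₂)₀` may therefore be computed in `𝓛(E₁, E₂)`. -/
theorem Lip.apply_mem_lipZero [ContinuousSMul ℝ E] (L : Lip E (Lip E₁ E₂)) (x : E) :
    L x ∈ LipZero E₁ E₂ :=
  mem_lipZero_of_isPreconnected (S := range fun x => L x)
    (by
      rw [← image_univ]
      exact (convex_univ.isPreconnected).image _ L.continuous.continuousOn)
    ⟨0, L.map_zero⟩ ⟨x, rfl⟩

variable (E₁ E₂) in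
/-- The inclusion of the identity component. -/
def lipZeroIncl : Lip (LipZero E₁ E₂) (Lip E₁ E₂) :=
  ⟨(LipZero E₁ E₂).subtype, 1, fun x => by simp⟩

variable (E E₁ E₂) in
/-- Linear maps on a connected space have values in the identity component. -/
def lipZeroLift [ContinuousSMul ℝ E] :
    Lip (Lip E (Lip E₁ E₂)) (Lip E (LipZero E₁ E₂)) :=
  ⟨{ toFun := fun L => ⟨L.1.codRestrict (LipZero E₁ E₂) L.apply_mem_lipZero, ‖L‖,
        fun x => L.norm_apply_le x⟩
     map_add' := fun _ _ => rfl
     map_smul' := fun _ _ => rfl },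
    1, fun L => by
      rw [one_mul]
      exact Lip.norm_le_of_bound _ (norm_nonneg _) fun x => L.norm_apply_le x⟩

theorem IsBC.of_coe_lipZero [ContinuousSMul ℝ E] {k : ℕ} {Q : E → LipZero E₁ E₂} {U : Set E}
    (h : IsBC k (fun x => (Q x : Lip E₁ E₂)) U) : IsBC k Q U := by
  cases k with
  | zero => exact fun x hx => tendsto_subtype_rng.2 (h x hx)
  | succ k =>
    obtain ⟨P', h1, h2⟩ := id h
    refine ⟨fun x => lipZeroLift E E₁ E₂ (P' x), ⟨?_, fun p hp k => ?_, ?_⟩, ?_⟩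
    · exact fun x hx => tendsto_subtype_rng.2 (h1.continuousOn x hx)
    · exact tendsto_subtype_rng.2 (h1.hasDirDeriv p hp k)
    · exact (lipZeroLift E E₁ E₂).continuous.comp_continuousOn h1.continuousOn_deriv
    · exact h2.lip_comp _

variable [StandardMetric E] [ContinuousSMul ℝ E]
variable {G : Type u} [NormedAddCommGroup G] [Module ℝ G] [StandardMetric G]

/-- Balls are connected, so on a ball the continuous map `T - T x₀` has a connected image through
`0` and stays in the identity component. -/
theorem exists_ball_lipZero {T : E → Lip E₁ E₂} {U : Set E} (hU : IsOpen U)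
    (hT : ContinuousOn T U) {x₀ : E} (hx₀ : x₀ ∈ U) :
    ∃ V : Set E, IsOpen V ∧ IsConnected V ∧ x₀ ∈ V ∧ V ⊆ U ∧
      ∃ Q : E → LipZero E₁ E₂, ∀ x ∈ V, (Q x : Lip E₁ E₂) = T x - T x₀ := by
  obtain ⟨r, hr, hrU⟩ := Metric.isOpen_iff.1 hU x₀ hx₀
  have hc := StandardMetric.isConnected_ball x₀ hr
  have hx : x₀ ∈ Metric.ball x₀ r := Metric.mem_ball_self hr
  have hmem : ∀ x ∈ Metric.ball x₀ r, T x - T x₀ ∈ LipZero E₁ E₂ := fun x hx' =>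
    mem_lipZero_of_isPreconnected
      (hc.isPreconnected.image (fun x => T x - T x₀) ((hT.mono hrU).sub continuousOn_const))
      ⟨x₀, hx, sub_self _⟩ ⟨x, hx', rfl⟩
  classical
  refine ⟨_, Metric.isOpen_ball, hc, hx, hrU,
    fun x => if h : x ∈ Metric.ball x₀ r then ⟨_, hmem x h⟩ else 0, fun x hx' => ?_⟩
  simp only [dif_pos hx']

theorem IsBC.of_sub_const {k : ℕ} {T : E → Lip E₁ E₂} {V : Set E} (hV : IsOpen V) {x₀ : E}
    {Q : E → LipZero E₁ E₂} (hQ : ∀ x ∈ V, (Q x : Lip E₁ E₂) = T x - T x₀) (h : IsBC k Q V) :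
    IsBC k T V :=
  ((h.lip_comp (lipZeroIncl E₁ E₂)).add (const k (T x₀) V)).congr hV fun x hx => by
    change (Q x : Lip E₁ E₂) + T x₀ = T x
    rw [hQ x hx, sub_add_cancel]

theorem IsBC.sub_const {k : ℕ} {T : E → Lip E₁ E₂} {V : Set E} (hV : IsOpen V) {x₀ : E}
    {Q : E → LipZero E₁ E₂} (hQ : ∀ x ∈ V, (Q x : Lip E₁ E₂) = T x - T x₀) (h : IsBC k T V) :
    IsBC k Q V :=
  of_coe_lipZero ((h.add (const k (-T x₀) V)).congr hV fun x hx => by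
    change T x + -T x₀ = (Q x : Lip E₁ E₂)
    rw [hQ x hx, sub_eq_add_neg])

/-- Locally, passing between `P'` and `P' - P' x₀` in the identity component changes neither
continuity nor derivatives. The component condition itself is automatic on small balls, so the
localizations in the definition of `MC^k` can be dropped. -/
theorem isMC_iff_isBC {k : ℕ} {P : E → G} {U : Set E} (hU : IsOpen U) :
    IsMC k P U ↔ IsBC k P U := by
  induction k generalizing G U with
  | zero => exact Iff.rfl
  | succ k ih =>
    constructor
    · rintro ⟨P', h1, h2⟩
      refine ⟨P', h1, IsBC.of_locally fun x₀ hx₀ => ?_⟩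
      obtain ⟨V, hV, -, hxV, -, Q, hQ, hQk⟩ := h2 x₀ hx₀
      exact ⟨V, hV, hxV, IsBC.of_sub_const hV hQ ((ih hV).1 hQk)⟩
    · rintro ⟨P', h1, h2⟩
      refine ⟨P', h1, fun x₀ hx₀ => ?_⟩
      obtain ⟨V, hV, hVc, hxV, hVU, Q, hQ⟩ := exists_ball_lipZero hU h1.continuousOn_deriv hx₀
      exact ⟨V, hV, hVc, hxV, hVU, Q, hQ, (ih hV).2 ((h2.mono hVU).sub_const hV hQ)⟩

/-- `P` is infinitely often b-differentiable on `U`. -/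
def IsBCInf (P : E → G) (U : Set E) : Prop := ∀ k, IsBC k P U

theorem isMCInf_iff {P : E → G} {U : Set E} (hU : IsOpen U) : IsMCInf P U ↔ IsBCInf P U :=
  forall_congr' fun _ => isMC_iff_isBC hU

theorem isMCInfLip_iff {T : E → Lip E₁ E₂} {U : Set E} (hU : IsOpen U) :
    IsMCInfLip T U ↔ IsBCInf T U := by
  constructor
  · intro h k
    refine IsBC.of_locally fun x₀ hx₀ => ?_
    obtain ⟨V, hV, -, hxV, -, Q, hQ, hQk⟩ := h x₀ hx₀
    exact ⟨V, hV, hxV, IsBC.of_sub_const hV hQ ((isMCInf_iff hV).1 hQk k)⟩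
  · intro h x₀ hx₀
    obtain ⟨V, hV, hVc, hxV, hVU, Q, hQ⟩ := exists_ball_lipZero hU (h 0).continuousOn hx₀
    exact ⟨V, hV, hVc, hxV, hVU, Q, hQ,
      (isMCInf_iff hV).2 fun k => ((h k).mono hVU).sub_const hV hQ⟩

end Comparison

/-! ### Calculus of infinitely b-differentiable maps -/

namespace IsBCInf

variable {E : Type u} [NormedAddCommGroup E] [Module ℝ E] [ContinuousSMul ℝ E]
variable {G : Type u} [NormedAddCommGroup G] [Module ℝ G] [StandardMetric G]
variable {G₁ : Type u} [NormedAddCommGroup G₁] [Module ℝ G₁] [StandardMetric G₁]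
variable {G₂ : Type u} [NormedAddCommGroup G₂] [Module ℝ G₂] [StandardMetric G₂]
variable {G₃ : Type u} [NormedAddCommGroup G₃] [Module ℝ G₃] [StandardMetric G₃]

theorem mono {P : E → G} {U V : Set E} (h : IsBCInf P U) (hV : V ⊆ U) : IsBCInf P V :=
  fun k => (h k).mono hV

theorem congr {P Q : E → G} {U : Set E} (h : IsBCInf P U) (hU : IsOpen U) (hPQ : EqOn P Q U) :
    IsBCInf Q U := fun k => (h k).congr hU hPQ

theorem const (a : G) (U : Set E) : IsBCInf (fun _ => a) U := fun k => .const k a U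

theorem lip (L : Lip E G) (U : Set E) : IsBCInf (fun x => L x) U := fun k => .lip k L U

theorem lip_comp (L : Lip G G₁) {P : E → G} {U : Set E} (h : IsBCInf P U) :
    IsBCInf (fun x => L (P x)) U := fun k => (h k).lip_comp L

theorem add {P Q : E → G} {U : Set E} (hP : IsBCInf P U) (hQ : IsBCInf Q U) :
    IsBCInf (fun x => P x + Q x) U := fun k => (hP k).add (hQ k)

theorem prodMk {P : E → G} {Q : E → G₁} {U : Set E} (hP : IsBCInf P U) (hQ : IsBCInf Q U) :
    IsBCInf (fun x => (P x, Q x)) U := fun k => (hP k).prodMk (hQ k)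

theorem bilin (β : Lip G₁ (Lip G₂ G₃)) {a : E → G₁} {b : E → G₂} {U : Set E} (hU : IsOpen U)
    (ha : IsBCInf a U) (hb : IsBCInf b U) : IsBCInf (fun x => β (a x) (b x)) U :=
  fun k => (ha k).bilin β hU (hb k)

theorem apply {a : E → Lip G₁ G₂} {b : E → G₁} {U : Set E} (ha : IsBCInf a U)
    (hU : IsOpen U) (hb : IsBCInf b U) : IsBCInf (fun x => a x (b x)) U :=
  bilin (Lip.id (Lip G₁ G₂)) hU ha hb

theorem lipComp {a : E → Lip G₁ G₂} {b : E → Lip G G₁} {U : Set E} (ha : IsBCInf a U)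
    (hU : IsOpen U) (hb : IsBCInf b U) : IsBCInf (fun x => (a x).comp (b x)) U :=
  bilin (Lip.compL G G₁ G₂) hU ha hb

theorem comp [ContinuousSMul ℝ G₁] {P : G₁ → G} {U : Set G₁} {Q : E → G₁} {V : Set E}
    (hP : IsBCInf P U) (hU : IsOpen U) (hQ : IsBCInf Q V) (hV : IsOpen V) (hm : MapsTo Q V U) :
    IsBCInf (fun x => P (Q x)) V := fun k => (hP k).comp hU (hQ k) hV hm

theorem of_locally {P : E → G} {U : Set E}
    (h : ∀ x ∈ U, ∃ V, IsOpen V ∧ x ∈ V ∧ IsBCInf P V) : IsBCInf P U := fun k =>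
  .of_locally fun x hx => by
    obtain ⟨V, hV, hxV, h'⟩ := h x hx
    exact ⟨V, hV, hxV, h' k⟩

theorem isBDiff {P : E → G} {U : Set E} (h : IsBCInf P U) (hU : IsOpen U) :
    IsBDiff P (bderiv P) U := by
  obtain ⟨P', h1, -⟩ := h 1
  exact h1.congr hU (fun _ _ => rfl) fun x hx => (h1.bderiv_eq hx).symm

theorem deriv {P : E → G} {U : Set E} (h : IsBCInf P U) (hU : IsOpen U) :
    IsBCInf (bderiv P) U := fun k => by
  obtain ⟨P', h1, h2⟩ := h (k + 1)
  exact h2.congr hU fun x hx => (h1.bderiv_eq hx).symm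

theorem hasDirDeriv {P : E → G} {U : Set E} (h : IsBCInf P U) (hU : IsOpen U) {x : E}
    (hx : x ∈ U) (k : E) : HasDirDeriv P x k (bderiv P x k) :=
  (h.isBDiff hU).hasDirDeriv x hx k

theorem dirDeriv_eq {P : E → G} {U : Set E} (h : IsBCInf P U) (hU : IsOpen U) {x : E}
    (hx : x ∈ U) (k : E) : dirDeriv P x k = bderiv P x k :=
  (h.hasDirDeriv hU hx k).dirDeriv_eq

end IsBCInf

/-! ### Symmetry of the second derivative -/

section Symmetry

variable {E : Type u} [NormedAddCommGroup E] [Module ℝ E] [StandardMetric E] [ContinuousSMul ℝ E]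
variable {G : Type u} [NormedAddCommGroup G] [Module ℝ G] [StandardMetric G]

theorem HasDirDeriv.const_smul {E₀ : Type*} [AddCommGroup E₀] [Module ℝ E₀] {P : E₀ → G}
    {p h : E₀} {y : G} (c : ℝ) (hy : HasDirDeriv P p h y) :
    HasDirDeriv (fun x => c • P x) p h (c • y) :=
  hy.lip_comp (c • Lip.id G)

theorem HasDirDeriv.comp_add_right {E₀ : Type*} [AddCommGroup E₀] [Module ℝ E₀] {P : E₀ → G}
    {p h a : E₀} {y : G} (hy : HasDirDeriv P (p + a) h y) :
    HasDirDeriv (fun x => P (x + a)) p h y := by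
  refine Tendsto.congr (fun t => ?_) hy
  rw [add_right_comm]

/-- Two nested mean value estimates: one for `y ↦ t⁻¹ • (P (y + t • g) - P y)` in the direction `h`,
and one for `P'` in the direction `g` to control its derivative. The mixed difference quotient is
symmetric in `g` and `h`, hence so is the limit. -/
theorem tendsto_second_difference {P : E → G} {P' : E → Lip E G} {P'' : E → Lip E (Lip E G)}
    {U : Set E} (hU : IsOpen U) (hP : IsBDiff P P' U) (hP' : IsBDiff P' P'' U) {x : E}
    (hx : x ∈ U) (g h : E) :
    Tendsto (fun t : ℝ => t⁻¹ • (t⁻¹ • (P (x + t • h + t • g) - P (x + t • h))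
      - t⁻¹ • (P (x + t • g) - P x))) (𝓝[≠] 0) (𝓝 (P'' x g h)) := by
  rw [Metric.tendsto_nhds]
  intro ε hε
  set η := ε / (‖g‖ * ‖h‖ + 1) / 2 with hη
  have hc0 : 0 < ‖g‖ * ‖h‖ + 1 := by positivity
  have hη0 : 0 < η := by positivity
  have hcont : ContinuousAt P'' x := hP'.continuousOn_deriv.continuousAt (hU.mem_nhds hx)
  have hball : ∀ᶠ z in 𝓝 x, z ∈ U ∧ ‖P'' z - P'' x‖ ≤ η := by
    filter_upwards [hU.mem_nhds hx, Metric.tendsto_nhds.1 hcont η hη0] with z hz hz'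
    exact ⟨hz, by rw [← dist_eq_norm]; exact hz'.le⟩
  obtain ⟨δ, hδ, hδ'⟩ := Metric.eventually_nhds_iff.1 hball
  have e1 : ∀ᶠ t in 𝓝[≠] (0 : ℝ), ‖t • h‖ + ‖t • g‖ < δ := by
    have : Continuous fun t : ℝ => ‖t • h‖ + ‖t • g‖ := by fun_prop
    have := (this.tendsto 0).mono_left (nhdsWithin_le_nhds (s := {(0 : ℝ)}ᶜ))
    exact this.eventually_lt_const (by simpa using hδ)
  filter_upwards [e1, self_mem_nhdsWithin] with t h1 ht
  have ht : t ≠ 0 := ht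
  -- Every point met by either mean value estimate lies in this parallelogram, which shrinks to `x`
  -- because factors in `[0, 1]` do not increase the norm.
  have near : ∀ r ∈ Icc (0 : ℝ) 1, ∀ s ∈ Icc (0 : ℝ) 1,
      x + (r * t) • h + (s * t) • g ∈ U ∧ ‖P'' (x + (r * t) • h + (s * t) • g) - P'' x‖ ≤ η := by
    intro r hr s hs
    refine hδ' ?_
    rw [dist_eq_norm, add_assoc, add_sub_cancel_left, mul_smul, mul_smul]
    refine ((norm_add_le _ _).trans (add_le_add ?_ ?_)).trans_lt h1
    · exact StandardMetric.norm_smul_le (by rw [abs_of_nonneg hr.1]; exact hr.2) _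
    · exact StandardMetric.norm_smul_le (by rw [abs_of_nonneg hs.1]; exact hs.2) _
  have h0 : (0 : ℝ) ∈ Icc (0 : ℝ) 1 := by simp
  have h1' : (1 : ℝ) ∈ Icc (0 : ℝ) 1 := by simp
  have key := HasDirDeriv.norm_slope_sub_le (P := fun y => t⁻¹ • (P (y + t • g) - P y))
    (P' := fun y => t⁻¹ • (P' (y + t • g) - P' y)) (x := x) (k := h) (C := η * ‖g‖ * ‖h‖) ht
    (P'' x g h) fun r hr => ⟨?_, ?_⟩
  · rw [dist_eq_norm]
    refine key.trans_lt ?_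
    calc η * ‖g‖ * ‖h‖ ≤ η * (‖g‖ * ‖h‖ + 1) := by nlinarith
      _ = ε / 2 := by rw [hη]; field_simp
      _ < ε := by linarith
  · have m0 := (near r hr 0 h0).1
    have m1 := (near r hr 1 h1').1
    simp only [zero_mul, zero_smul, add_zero, one_mul] at m0 m1
    exact (((hP.hasDirDeriv _ m1 h).comp_add_right).sub (hP.hasDirDeriv _ m0 h)).const_smul t⁻¹
  · have := hP'.norm_slope_sub_le ht (P'' x) (fun s hs => near r hr s hs) (k := g)
    exact ((t⁻¹ • (P' (x + (r * t) • h + t • g) - P' (x + (r * t) • h)) - P'' x g).norm_apply_le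
      h).trans (mul_le_mul_of_nonneg_right this (norm_nonneg _))

theorem second_deriv_symm {P : E → G} {P' : E → Lip E G} {P'' : E → Lip E (Lip E G)}
    {U : Set E} (hU : IsOpen U) (hP : IsBDiff P P' U) (hP' : IsBDiff P' P'' U) {x : E}
    (hx : x ∈ U) (g h : E) : P'' x g h = P'' x h g := by
  refine tendsto_nhds_unique (tendsto_second_difference hU hP hP' hx g h)
    ((tendsto_second_difference hU hP hP' hx h g).congr fun t => ?_)
  rw [← smul_sub, ← smul_sub, add_right_comm x]
  congr 2
  abel

theorem IsBCInf.bderiv_symm {P : E → G} {U : Set E} (h : IsBCInf P U) (hU : IsOpen U) {x : E}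
    (hx : x ∈ U) (g k : E) :
    bderiv (bderiv P) x g k = bderiv (bderiv P) x k g :=
  second_deriv_symm hU (h.isBDiff hU) ((h.deriv hU).isBDiff hU) hx g k

end Symmetry

/-! ### Curves -/

section Curves

variable {E : Type u} [NormedAddCommGroup E] [Module ℝ E]
variable {G : Type u} [NormedAddCommGroup G] [Module ℝ G] [StandardMetric G]

theorem HasDirDeriv.tendsto {E₀ : Type*} [AddCommGroup E₀] [Module ℝ E₀] [ContinuousSMul ℝ E]
    {c : E₀ → E} {p h : E₀} {y : E} (hc : HasDirDeriv c p h y) :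
    Tendsto (fun t : ℝ => c (p + t • h)) (𝓝[≠] 0) (𝓝 (c p)) := by
  have h0 : Tendsto (fun t : ℝ => t) (𝓝[≠] 0) (𝓝 0) := nhdsWithin_le_nhds
  have h1 := (h0.smul hc).add_const (c p)
  rw [zero_smul, zero_add] at h1
  refine h1.congr' ?_
  filter_upwards [self_mem_nhdsWithin] with t ht
  have ht : t ≠ 0 := ht
  rw [smul_smul, mul_inv_cancel₀ ht, one_smul, sub_add_cancel]

theorem HasDirDeriv.continuousAt [ContinuousSMul ℝ E] {c : ℝ → E} {t : ℝ} {y : E}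
    (hc : HasDirDeriv c t 1 y) : ContinuousAt c t := by
  rw [continuousAt_iff_punctured_nhds]
  have h1 : Tendsto (fun s : ℝ => s - t) (𝓝[≠] t) (𝓝[≠] 0) := by
    refine tendsto_nhdsWithin_iff.2 ⟨?_, ?_⟩
    · have : Continuous fun s : ℝ => s - t := by fun_prop
      simpa using (this.tendsto t).mono_left nhdsWithin_le_nhds
    · filter_upwards [self_mem_nhdsWithin] with s hs
      exact sub_ne_zero.2 hs
  refine (hc.tendsto.comp h1).congr fun s => ?_
  simp

theorem HasDirDeriv.curveDeriv_eq {c : ℝ → E} {t : ℝ} {y : E} (hc : HasDirDeriv c t 1 y) :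
    curveDeriv c t = y := hc.dirDeriv_eq

/-- `c` is `k` times continuously differentiable on the set `I`. -/
def IsCurveC : ℕ → ∀ {G : Type u} [NormedAddCommGroup G] [Module ℝ G], (ℝ → G) → Set ℝ → Prop
  | 0, _, _, _, c, I => ContinuousOn c I
  | k + 1, G, _, _, c, I => ∃ c' : ℝ → G, ContinuousOn c I ∧
      (∀ t ∈ I, HasDirDeriv c t 1 (c' t)) ∧ IsCurveC k c' I

namespace IsCurveC

variable {G₁ : Type u} [NormedAddCommGroup G₁] [Module ℝ G₁] [StandardMetric G₁]
variable {G₂ : Type u} [NormedAddCommGroup G₂] [Module ℝ G₂] [StandardMetric G₂]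
variable {G₃ : Type u} [NormedAddCommGroup G₃] [Module ℝ G₃] [StandardMetric G₃]

theorem continuousOn {k : ℕ} {c : ℝ → E} {I : Set ℝ} (h : IsCurveC k c I) :
    ContinuousOn c I := by
  cases k with
  | zero => exact h
  | succ k => exact h.choose_spec.1

theorem of_succ {k : ℕ} {c : ℝ → E} {I : Set ℝ} (h : IsCurveC (k + 1) c I) :
    IsCurveC k c I := by
  induction k generalizing c with
  | zero => exact h.continuousOn
  | succ k ih =>
    obtain ⟨c', h1, h2, h3⟩ := h
    exact ⟨c', h1, h2, ih h3⟩

theorem mono {k : ℕ} {c : ℝ → E} {I J : Set ℝ} (h : IsCurveC k c I) (hJ : J ⊆ I) :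
    IsCurveC k c J := by
  induction k generalizing c with
  | zero => exact ContinuousOn.mono h hJ
  | succ k ih =>
    obtain ⟨c', h1, h2, h3⟩ := h
    exact ⟨c', h1.mono hJ, fun t ht => h2 t (hJ ht), ih h3⟩

theorem congr {k : ℕ} {c d : ℝ → E} {I : Set ℝ} (h : IsCurveC k c I) (hI : IsOpen I)
    (hcd : EqOn c d I) : IsCurveC k d I := by
  cases k with
  | zero => exact ContinuousOn.congr h hcd.symm
  | succ k =>
    obtain ⟨c', h1, h2, h3⟩ := h
    exact ⟨c', h1.congr hcd.symm, fun t ht => (h2 t ht).congr_of_eventuallyEq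
      (hcd.eventuallyEq_of_mem (hI.mem_nhds ht)), h3⟩

theorem add {k : ℕ} {c d : ℝ → G} {I : Set ℝ} (hc : IsCurveC k c I) (hd : IsCurveC k d I) :
    IsCurveC k (fun t => c t + d t) I := by
  induction k generalizing c d with
  | zero => exact ContinuousOn.add hc hd
  | succ k ih =>
    obtain ⟨c', h1, h2, h3⟩ := hc
    obtain ⟨d', h4, h5, h6⟩ := hd
    exact ⟨_, h1.add h4, fun t ht => (h2 t ht).add (h5 t ht), ih h3 h6⟩

theorem bilin {k : ℕ} (β : Lip G₁ (Lip G₂ G₃)) {a : ℝ → G₁} {b : ℝ → G₂} {I : Set ℝ}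
    (hI : IsOpen I) (ha : IsCurveC k a I) (hb : IsCurveC k b I) :
    IsCurveC k (fun t => β (a t) (b t)) I := by
  induction k generalizing a b with
  | zero => exact Lip.continuousOn_bilin β ha hb
  | succ k ih =>
    obtain ⟨a', h1, h2, h3⟩ := id ha
    obtain ⟨b', h4, h5, h6⟩ := id hb
    refine ⟨fun t => β (a' t) (b t) + β (a t) (b' t), Lip.continuousOn_bilin β h1 h4,
      fun t ht => HasDirDeriv.bilin β (h2 t ht) (h5 t ht) ?_,
      (ih h3 hb.of_succ).add (ih ha.of_succ h6)⟩
    exact (h4.continuousAt (hI.mem_nhds ht)).tendsto.comp (tendsto_add_smul t 1)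

theorem comp [StandardMetric E] [ContinuousSMul ℝ E] {k : ℕ} {P : E → G} {U : Set E}
    (hP : IsBC k P U) (hU : IsOpen U) {c : ℝ → E} {I : Set ℝ} (hI : IsOpen I)
    (hc : IsCurveC k c I) (hm : MapsTo c I U) : IsCurveC k (fun t => P (c t)) I := by
  induction k generalizing G with
  | zero => exact ContinuousOn.comp hP hc hm
  | succ k ih =>
    obtain ⟨P', h1, h2⟩ := hP
    obtain ⟨c', h3, h4, h5⟩ := id hc
    exact ⟨fun t => P' (c t) (c' t), h1.continuousOn.comp h3 hm,
      fun t ht => h1.comp_hasDirDeriv hU (h4 t ht) (hm ht),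
      bilin (Lip.id (Lip E G)) hI (ih h2 hc.of_succ) h5⟩

theorem hasDirDeriv_iterate {k : ℕ} {c : ℝ → E} {I : Set ℝ} (hI : IsOpen I)
    (hc : IsCurveC (k + 1) c I) {t : ℝ} (ht : t ∈ I) :
    ∃ y, HasDirDeriv (curveDeriv^[k] c) t 1 y := by
  induction k generalizing c with
  | zero =>
    obtain ⟨c', -, h, -⟩ := hc
    exact ⟨_, h t ht⟩
  | succ k ih =>
    obtain ⟨c', -, h, h'⟩ := hc
    exact ih (h'.congr hI fun s hs => (h s hs).curveDeriv_eq.symm)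

theorem const (k : ℕ) (x : E) (I : Set ℝ) : IsCurveC k (fun _ => x) I := by
  induction k generalizing x with
  | zero => exact continuousOn_const
  | succ k ih =>
    exact ⟨fun _ => 0, continuousOn_const, fun t _ => hasDirDeriv_const x t 1, ih 0⟩

end IsCurveC

theorem HasDerivAt.hasDirDeriv_smul_const [ContinuousSMul ℝ E] {ρ : ℝ → ℝ} {ρ' t : ℝ}
    (h : HasDerivAt ρ ρ' t) (x : E) : HasDirDeriv (fun t => ρ t • x) t 1 (ρ' • x) := by
  have := (hasDerivAt_iff_tendsto_slope_zero.1 h).smul_const x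
  refine this.congr fun s => ?_
  simp [sub_smul, smul_sub, mul_smul]

theorem ContDiff.isCurveC_smul_const [ContinuousSMul ℝ E] {k : ℕ} {ρ : ℝ → ℝ}
    (h : ContDiff ℝ k ρ) (x : E) : IsCurveC k (fun t => ρ t • x) univ := by
  induction k generalizing ρ with
  | zero =>
    have := h.continuous
    exact Continuous.continuousOn (by fun_prop)
  | succ k ih =>
    have hc := h.continuous
    have h' : ContDiff ℝ (k + 1) ρ := by exact_mod_cast h
    refine ⟨fun t => deriv ρ t • x, Continuous.continuousOn (by fun_prop), fun t _ => ?_,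
      ih (contDiff_succ_iff_deriv.1 h').2.2⟩
    exact HasDerivAt.hasDirDeriv_smul_const
      ((h'.differentiable (by simp)) t).hasDerivAt x

/-- Existence of smooth curves with prescribed derivatives up to order two. -/
theorem exists_isCurveC [StandardMetric E] [ContinuousSMul ℝ E] {W : Set E} (hW : IsOpen W) {x : E}
    (hx : x ∈ W) (v a : E) : ∃ c : ℝ → E, (∀ k, IsCurveC k c univ) ∧ (∀ t, c t ∈ W) ∧ c 0 = x ∧
      curveDeriv c 0 = v ∧ curveDeriv (curveDeriv c) 0 = a := by
  have hcont : Continuous fun z : ℝ × ℝ => x + z.1 • v + z.2 • a := by fun_prop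
  have hnhds : ∀ᶠ z in 𝓝 (0 : ℝ × ℝ), x + z.1 • v + z.2 • a ∈ W :=
    (hcont.tendsto 0).eventually (by simpa using hW.mem_nhds hx)
  obtain ⟨δ, hδ, h⟩ := Metric.eventually_nhds_iff.1 hnhds
  -- With `ε ≤ δ / 4` and `ε ≤ 1`, both `ε |sin|` and `ε² (1 - cos) ≤ 2 ε` stay below `δ`.
  set ε := min (δ / 4) 1 with hε
  have hε0 : 0 < ε := by positivity
  have hεδ : ε ≤ δ / 4 := min_le_left _ _
  have hε1 : ε ≤ 1 := min_le_right _ _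
  have d1 : ∀ t, HasDerivAt (fun t => ε * Real.sin (t / ε)) (Real.cos (t / ε)) t := fun t => by
    have := ((Real.hasDerivAt_sin (t / ε)).comp t ((hasDerivAt_id t).div_const ε)).const_mul ε
    exact this.congr_deriv (by field_simp)
  have d2 : ∀ t, HasDerivAt (fun t => ε ^ 2 * (1 - Real.cos (t / ε)))
      (ε * Real.sin (t / ε)) t := fun t => by
    have := (((Real.hasDerivAt_cos (t / ε)).comp t
      ((hasDerivAt_id t).div_const ε)).const_sub 1).const_mul (ε ^ 2)
    exact this.congr_deriv (by field_simp)
  have d3 : HasDerivAt (fun t => Real.cos (t / ε)) 0 0 := by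
    have := (Real.hasDerivAt_cos ((0 : ℝ) / ε)).comp 0 ((hasDerivAt_id (0 : ℝ)).div_const ε)
    exact this.congr_deriv (by simp)
  -- Jets are defined by curves on all of `ℝ`, so the Taylor coefficients `t` and `t² / 2` are
  -- replaced by bounded functions with the same derivatives up to order two at `0`. The whole curve
  -- then stays in `W`.
  let c : ℝ → E := fun t => x + (ε * Real.sin (t / ε)) • v + (ε ^ 2 * (1 - Real.cos (t / ε))) • a
  have c1 : ∀ t, HasDirDeriv c t 1 (0 + Real.cos (t / ε) • v + (ε * Real.sin (t / ε)) • a) :=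
    fun t => ((hasDirDeriv_const x t 1).add ((d1 t).hasDirDeriv_smul_const v)).add
      ((d2 t).hasDirDeriv_smul_const a)
  have c1' : curveDeriv c = fun t => Real.cos (t / ε) • v + (ε * Real.sin (t / ε)) • a :=
    funext fun t => by rw [(c1 t).curveDeriv_eq, zero_add]
  refine ⟨c, fun k => ?_, fun t => ?_, by simp [c], by simp [c1'], ?_⟩
  · refine ((IsCurveC.const k x univ).add (ContDiff.isCurveC_smul_const ?_ v)).add
      (ContDiff.isCurveC_smul_const ?_ a)
    · fun_prop
    · fun_prop
  · refine h (y := (ε * Real.sin (t / ε), ε ^ 2 * (1 - Real.cos (t / ε)))) ?_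
    rw [dist_zero_right, Prod.norm_def, max_lt_iff]
    constructor
    · rw [Real.norm_eq_abs, abs_mul, abs_of_pos hε0]
      have := Real.abs_sin_le_one (t / ε)
      nlinarith
    · have h1 := Real.cos_le_one (t / ε)
      have h2 := Real.neg_one_le_cos (t / ε)
      rw [Real.norm_eq_abs, abs_of_nonneg (mul_nonneg (sq_nonneg _) (by linarith))]
      nlinarith
  · rw [c1', ((d3.hasDirDeriv_smul_const v).add ((d1 0).hasDirDeriv_smul_const a)).curveDeriv_eq]
    simp

/-- The first two derivatives of a curve under a smooth map. -/
theorem IsBCInf.curveDeriv_comp [StandardMetric E] [ContinuousSMul ℝ E] {P : E → G} {U : Set E}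
    (hP : IsBCInf P U) (hU : IsOpen U) {c : ℝ → E} {t : ℝ} (ht : c t ∈ U) {y : E}
    (h : HasDirDeriv c t 1 y) :
    curveDeriv (fun s => P (c s)) t = bderiv P (c t) y :=
  ((hP.isBDiff hU).comp_hasDirDeriv hU h ht).curveDeriv_eq

theorem IsBCInf.hasDirDeriv_curveDeriv_comp [StandardMetric E] [ContinuousSMul ℝ E] {P : E → G}
    {U : Set E} (hP : IsBCInf P U) (hU : IsOpen U) {c : ℝ → E} {t : ℝ} (ht : c t ∈ U) {y : E}
    (h : ∀ᶠ s in 𝓝 t, ∃ z, HasDirDeriv c s 1 z) (h2 : HasDirDeriv (curveDeriv c) t 1 y) :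
    HasDirDeriv (curveDeriv fun s => P (c s)) t 1
      (bderiv (bderiv P) (c t) (curveDeriv c t) (curveDeriv c t) + bderiv P (c t) y) := by
  obtain ⟨z, hz⟩ := h.self_of_nhds
  have e : (fun s => bderiv P (c s) (curveDeriv c s)) =ᶠ[𝓝 t] curveDeriv fun s => P (c s) := by
    filter_upwards [h, hz.continuousAt.eventually (hU.mem_nhds ht)] with s ⟨w, hw⟩ hs
    rw [hP.curveDeriv_comp hU hs hw, hw.curveDeriv_eq]
  refine HasDirDeriv.congr_of_eventuallyEq ?_ e
  have h1 := ((hP.deriv hU).isBDiff hU).comp_hasDirDeriv hU hz ht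
  rw [hz.curveDeriv_eq.symm] at h1
  exact HasDirDeriv.bilin (Lip.id (Lip E G)) h1 h2
    (h2.continuousAt.tendsto.comp (tendsto_add_smul t 1))

end Curves

/-! ### Smooth atlases and jets -/

section Atlas

variable {ι : Type w} {X : Type v} {E : Type u} [NormedAddCommGroup E] [Module ℝ E]
  [StandardMetric E]

/-- The image of the overlap of the charts `i` and `j` in the chart `i`. -/
def Charts.overlap (B : Charts ι X E) (i j : ι) : Set E := B.coord i '' (B.dom i ∩ B.dom j)

/-- `G` is the smooth change of coordinates from the chart `i` to the chart `j`. -/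
structure Charts.IsChange (B : Charts ι X E) (i j : ι) (G : E → E) : Prop where
  smooth : IsBCInf G (B.overlap i j)
  eq : ∀ x ∈ B.dom i ∩ B.dom j, B.coord j x = G (B.coord i x)

/-- The charts `B` form a smooth atlas. -/
structure Charts.IsAtlas (B : Charts ι X E) : Prop where
  cover : ∀ x, ∃ i, x ∈ B.dom i
  injOn : ∀ i, InjOn (B.coord i) (B.dom i)
  isOpen_overlap : ∀ i j, IsOpen (B.overlap i j)
  exists_change : ∀ i j, ∃ G, B.IsChange i j G

namespace Charts.IsAtlas

variable {B : Charts ι X E}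

theorem isOpen_target (hB : B.IsAtlas) (i : ι) : IsOpen (B.target i) := by
  have := hB.isOpen_overlap i i
  rwa [Charts.overlap, inter_self] at this

theorem coord_mem_overlap {i j : ι} {x : X} (hi : x ∈ B.dom i) (hj : x ∈ B.dom j) :
    B.coord i x ∈ B.overlap i j := ⟨x, ⟨hi, hj⟩, rfl⟩

theorem mem_dom_of_coord_mem (hB : B.IsAtlas) {i j : ι} {x : X} (hi : x ∈ B.dom i)
    (h : B.coord i x ∈ B.overlap i j) : x ∈ B.dom j := by
  obtain ⟨y, hy, e⟩ := h
  exact hB.injOn i hy.1 hi e ▸ hy.2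

variable [ContinuousSMul ℝ E]

/-- The model curve never leaves the chart image, so it can be lifted pointwise. By injectivity of
the chart, the times spent in another domain form the open preimage of an overlap, on which the
change of coordinates supplies smoothness. -/
theorem exists_isSmoothCurve (hB : B.IsAtlas) {i : ι} {x : E} (hx : x ∈ B.target i) (v a : E) :
    ∃ f : ℝ → X, IsSmoothCurve B f ∧ f 0 ∈ B.dom i ∧ B.coord i (f 0) = x ∧
      curveDeriv (B.coord i ∘ f) 0 = v ∧ curveDeriv^[2] (B.coord i ∘ f) 0 = a := by
  obtain ⟨c, hc, hcW, h0, h1, h2⟩ := exists_isCurveC (hB.isOpen_target i) hx v a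
  choose f hf hfc using hcW
  have e : B.coord i ∘ f = c := funext hfc
  refine ⟨f, fun j t ht => ?_, hf 0, by rw [hfc, h0], by rw [e, h1], ?_⟩
  · have hI : IsOpen (c ⁻¹' B.overlap i j) :=
      (hB.isOpen_overlap i j).preimage (continuousOn_univ.1 (hc 0).continuousOn)
    have htI : t ∈ c ⁻¹' B.overlap i j := by
      rw [mem_preimage, ← hfc]
      exact coord_mem_overlap (hf t) ht
    have hmem : ∀ s ∈ c ⁻¹' B.overlap i j, f s ∈ B.dom j := fun s hs =>
      hB.mem_dom_of_coord_mem (hf s) (by rw [hfc]; exact hs)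
    refine ⟨mem_of_superset (hI.mem_nhds htI) hmem, fun k => ?_⟩
    obtain ⟨G, hG⟩ := hB.exists_change i j
    have := IsCurveC.comp (hG.smooth (k + 1)) (hB.isOpen_overlap i j) hI
      ((hc (k + 1)).mono (subset_univ _)) fun s hs => hs
    refine (this.congr hI fun s hs => ?_).hasDirDeriv_iterate hI htI
    change G (c s) = B.coord j (f s)
    rw [hG.eq _ ⟨hf s, hmem s hs⟩, hfc]
  · rw [e]
    exact h2

/-- Existence of `1`-jets with prescribed coordinates. -/
theorem exists_jet_one (hB : B.IsAtlas) {i : ι} {p : X} (hp : p ∈ B.dom i) (v : E) :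
    ∃ ξ : Jet B 1, ξ.base = p ∧ ξ.deriv i 1 = v := by
  obtain ⟨f, hf, h0, hx, hv, -⟩ := hB.exists_isSmoothCurve (mem_image_of_mem (B.coord i) hp) v 0
  exact ⟨Jet.mk B 1 f hf, hB.injOn i h0 hp hx, by
    rw [Jet.deriv_mk B 1 f hf i h0 1 le_rfl le_rfl]; exact hv⟩

/-- Existence of `2`-jets with prescribed coordinates. -/
theorem exists_jet_two (hB : B.IsAtlas) {i : ι} {p : X} (hp : p ∈ B.dom i) (v a : E) :
    ∃ ξ : Jet B 2, ξ.base = p ∧ ξ.deriv i 1 = v ∧ ξ.deriv i 2 = a := by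
  obtain ⟨f, hf, h0, hx, hv, ha⟩ := hB.exists_isSmoothCurve (mem_image_of_mem (B.coord i) hp) v a
  exact ⟨Jet.mk B 2 f hf, hB.injOn i h0 hp hx, by
    rw [Jet.deriv_mk B 2 f hf i h0 1 le_rfl one_le_two]; exact hv, by
    rw [Jet.deriv_mk B 2 f hf i h0 2 one_le_two le_rfl]; exact ha⟩

theorem _root_.IsSmoothCurve.hasDirDeriv {f : ℝ → X} (hf : IsSmoothCurve B f) {i : ι} {t : ℝ}
    (h : f t ∈ B.dom i) :
    HasDirDeriv (B.coord i ∘ f) t 1 (curveDeriv (B.coord i ∘ f) t) := by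
  obtain ⟨y, hy⟩ := (hf i t h).2 0
  have hy : HasDirDeriv (B.coord i ∘ f) t 1 y := hy
  rwa [hy.curveDeriv_eq]

theorem _root_.IsSmoothCurve.hasDirDeriv_curveDeriv {f : ℝ → X} (hf : IsSmoothCurve B f) {i : ι}
    {t : ℝ} (h : f t ∈ B.dom i) : HasDirDeriv (curveDeriv (B.coord i ∘ f)) t 1
      (curveDeriv (curveDeriv (B.coord i ∘ f)) t) := by
  obtain ⟨y, hy⟩ := (hf i t h).2 1
  have hy : HasDirDeriv (curveDeriv (B.coord i ∘ f)) t 1 y := hy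
  rwa [hy.curveDeriv_eq]

variable {i j : ι} {G : E → E}

theorem eventuallyEq_coord {f : ℝ → X} (hf : IsSmoothCurve B f)
    (hG : B.IsChange i j G) {t : ℝ} (hi : f t ∈ B.dom i) (hj : f t ∈ B.dom j) :
    (fun s => G ((B.coord i ∘ f) s)) =ᶠ[𝓝 t] B.coord j ∘ f := by
  filter_upwards [(hf i t hi).1, (hf j t hj).1] with s h1 h2
  exact (hG.eq _ ⟨h1, h2⟩).symm

theorem eventuallyEq_curveDeriv {f : ℝ → X} (hB : B.IsAtlas) (hf : IsSmoothCurve B f)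
    (hG : B.IsChange i j G) {t : ℝ} (hi : f t ∈ B.dom i) (hj : f t ∈ B.dom j) :
    curveDeriv (B.coord j ∘ f) =ᶠ[𝓝 t]
      fun s => bderiv G (B.coord i (f s)) (curveDeriv (B.coord i ∘ f) s) := by
  filter_upwards [(hf i t hi).1, (hf j t hj).1] with s h1 h2
  have := ((hG.smooth.isBDiff (hB.isOpen_overlap i j)).comp_hasDirDeriv
    (hB.isOpen_overlap i j) (hf.hasDirDeriv h1) (coord_mem_overlap h1 h2))
  exact (this.congr_of_eventuallyEq (eventuallyEq_coord hf hG h1 h2)).curveDeriv_eq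

theorem deriv_one_change (hB : B.IsAtlas) {r : ℕ} (hr : 1 ≤ r) (hG : B.IsChange i j G)
    (ξ : Jet B r) (hi : ξ.base ∈ B.dom i) (hj : ξ.base ∈ B.dom j) :
    ξ.deriv j 1 = bderiv G (B.coord i ξ.base) (ξ.deriv i 1) := by
  obtain ⟨⟨f, hf⟩, rfl⟩ := Quotient.exists_rep ξ
  have hi : f 0 ∈ B.dom i := hi
  have hj : f 0 ∈ B.dom j := hj
  change (Jet.mk B r f hf).deriv j 1 = bderiv G (B.coord i (f 0)) ((Jet.mk B r f hf).deriv i 1)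
  rw [Jet.deriv_mk B r f hf i hi 1 le_rfl hr, Jet.deriv_mk B r f hf j hj 1 le_rfl hr]
  exact (hB.eventuallyEq_curveDeriv hf hG hi hj).eq_of_nhds

/-- The quadratic term in the velocity prevents the jet charts from making `T²M` a vector bundle; it
is the term that Christoffel symbols compensate. -/
theorem deriv_two_change (hB : B.IsAtlas) (hG : B.IsChange i j G)
    (ξ : Jet B 2) (hi : ξ.base ∈ B.dom i) (hj : ξ.base ∈ B.dom j) :
    ξ.deriv j 2 = bderiv (bderiv G) (B.coord i ξ.base) (ξ.deriv i 1) (ξ.deriv i 1)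
      + bderiv G (B.coord i ξ.base) (ξ.deriv i 2) := by
  obtain ⟨⟨f, hf⟩, rfl⟩ := Quotient.exists_rep ξ
  have hi : f 0 ∈ B.dom i := hi
  have hj : f 0 ∈ B.dom j := hj
  change (Jet.mk B 2 f hf).deriv j 2 = bderiv (bderiv G) (B.coord i (f 0))
    ((Jet.mk B 2 f hf).deriv i 1) ((Jet.mk B 2 f hf).deriv i 1)
      + bderiv G (B.coord i (f 0)) ((Jet.mk B 2 f hf).deriv i 2)
  rw [Jet.deriv_mk B 2 f hf i hi 1 le_rfl one_le_two,
    Jet.deriv_mk B 2 f hf i hi 2 one_le_two le_rfl, Jet.deriv_mk B 2 f hf j hj 2 one_le_two le_rfl]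
  have h := hG.smooth.hasDirDeriv_curveDeriv_comp (hB.isOpen_overlap i j)
    (c := B.coord i ∘ f) (coord_mem_overlap hi hj)
    ((hf i 0 hi).1.mono fun s hs => ⟨_, hf.hasDirDeriv hs⟩) (hf.hasDirDeriv_curveDeriv hi)
  refine (h.congr_of_eventuallyEq ?_).curveDeriv_eq
  filter_upwards [hB.eventuallyEq_curveDeriv hf hG hi hj, (hf i 0 hi).1, (hf j 0 hj).1]
    with s hs h1 h2
  rw [hs]
  exact hG.smooth.curveDeriv_comp (hB.isOpen_overlap i j) (coord_mem_overlap h1 h2)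
    (hf.hasDirDeriv h1)

/-- `Jet.deriv` is read off from the chosen representative, so these equalities say precisely that
the two representatives are equivalent. -/
theorem _root_.Jet.ext_of_forall {r : ℕ} {ξ η : Jet B r} (h0 : ξ.base = η.base)
    (h : ∀ i, ξ.base ∈ B.dom i → ∀ m, 1 ≤ m → m ≤ r → ξ.deriv i m = η.deriv i m) : ξ = η := by
  rw [← Quotient.out_eq (s := jetSetoid B r) ξ, ← Quotient.out_eq (s := jetSetoid B r) η] at h0 ⊢
  refine Quotient.sound ⟨h0, fun i hi => h i ?_⟩
  rw [← Quotient.out_eq (s := jetSetoid B r) ξ]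
  exact hi

theorem jet_one_ext (hB : B.IsAtlas) {ξ η : Jet B 1} (h0 : ξ.base = η.base)
    (hi : ξ.base ∈ B.dom i) (h1 : ξ.deriv i 1 = η.deriv i 1) : ξ = η := by
  refine Jet.ext_of_forall h0 fun j hj m hm hm' => ?_
  obtain rfl : m = 1 := le_antisymm hm' hm
  obtain ⟨G, hG⟩ := hB.exists_change i j
  rw [hB.deriv_one_change le_rfl hG ξ hi hj,
    hB.deriv_one_change le_rfl hG η (h0 ▸ hi) (h0 ▸ hj), h0, h1]

theorem jet_two_ext (hB : B.IsAtlas) {ξ η : Jet B 2} (h0 : ξ.base = η.base)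
    (hi : ξ.base ∈ B.dom i) (h1 : ξ.deriv i 1 = η.deriv i 1)
    (h2 : ξ.deriv i 2 = η.deriv i 2) : ξ = η := by
  refine Jet.ext_of_forall h0 fun j hj m hm hm' => ?_
  obtain ⟨G, hG⟩ := hB.exists_change i j
  obtain rfl | rfl : m = 1 ∨ m = 2 := by omega
  · rw [hB.deriv_one_change one_le_two hG ξ hi hj,
      hB.deriv_one_change one_le_two hG η (h0 ▸ hi) (h0 ▸ hj), h0, h1]
  · rw [hB.deriv_two_change hG ξ hi hj,
      hB.deriv_two_change hG η (h0 ▸ hi) (h0 ▸ hj), h0, h1, h2]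

theorem tangent_overlap (hB : B.IsAtlas) (i j : ι) :
    (tangentCharts B).overlap i j = B.overlap i j ×ˢ univ := by
  ext ⟨x, v⟩
  constructor
  · rintro ⟨ξ, ⟨hi, hj⟩, e⟩
    obtain ⟨rfl, rfl⟩ := Prod.mk.inj e
    exact ⟨coord_mem_overlap hi hj, trivial⟩
  · rintro ⟨⟨p, ⟨hi, hj⟩, rfl⟩, -⟩
    obtain ⟨ξ, hξ, hv⟩ := hB.exists_jet_one hi v
    exact ⟨ξ, ⟨show ξ.base ∈ _ from hξ ▸ hi, show ξ.base ∈ _ from hξ ▸ hj⟩,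
      Prod.ext (congrArg (B.coord i) hξ) hv⟩

theorem _root_.IsBCInf.comp_fst {E₁ E₂ G : Type u} [NormedAddCommGroup E₁] [Module ℝ E₁]
    [StandardMetric E₁] [ContinuousSMul ℝ E₁] [NormedAddCommGroup E₂] [Module ℝ E₂]
    [StandardMetric E₂] [ContinuousSMul ℝ E₂] [NormedAddCommGroup G] [Module ℝ G]
    [StandardMetric G] {P : E₁ → G} {U : Set E₁} (hP : IsBCInf P U) (hU : IsOpen U)
    {S : Set E₂} (hS : IsOpen S) : IsBCInf (fun z : E₁ × E₂ => P z.1) (U ×ˢ S) :=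
  hP.comp hU (IsBCInf.lip (Lip.fst E₁ E₂) _) (hU.prod hS) fun _ hz => hz.1

theorem tangent_isChange (hB : B.IsAtlas) (hG : B.IsChange i j G) :
    (tangentCharts B).IsChange i j fun z => (G z.1, bderiv G z.1 z.2) where
  smooth := by
    have hO := hB.isOpen_overlap i j
    rw [hB.tangent_overlap]
    exact (hG.smooth.comp_fst hO isOpen_univ).prodMk
      (((hG.smooth.deriv hO).comp_fst hO isOpen_univ).apply (hO.prod isOpen_univ)
        (IsBCInf.lip (Lip.snd E E) _))
  eq ξ hξ := Prod.ext (hG.eq _ hξ) (hB.deriv_one_change le_rfl hG ξ hξ.1 hξ.2)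

/-- The tangent bundle of a manifold is a manifold. -/
theorem tangent (hB : B.IsAtlas) : (tangentCharts B).IsAtlas where
  cover ξ := hB.cover ξ.base
  injOn i ξ hξ η hη e := by
    obtain ⟨e1, e2⟩ := Prod.mk.inj e
    exact hB.jet_one_ext (hB.injOn i hξ hη e1) hξ e2
  isOpen_overlap i j := by
    rw [hB.tangent_overlap]
    exact (hB.isOpen_overlap i j).prod isOpen_univ
  exists_change i j := by
    obtain ⟨G, hG⟩ := hB.exists_change i j
    exact ⟨_, hB.tangent_isChange hG⟩

end Charts.IsAtlas

end Atlas

/-! ### The atlas of a manifold -/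

section Manifold

variable {F : Type u} [NormedAddCommGroup F] [Module ℝ F] [StandardMetric F]
variable {M : Type v} [TopologicalSpace M] [ChartedSpace F M]

theorem manifoldCharts_overlap (i j : atlas F M) :
    (manifoldCharts F M).overlap i j = (i.1.symm.trans j.1).source := by
  have := i.1.image_source_inter_eq' j.1.source
  rw [OpenPartialHomeomorph.trans_source]
  exact this

theorem manifoldCharts_isChange [BoundedFrechetManifold F M] [ContinuousSMul ℝ F]
    (i j : atlas F M) :
    (manifoldCharts F M).IsChange i j (j.1 ∘ i.1.symm) where
  smooth := by
    rw [manifoldCharts_overlap]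
    exact (isMCInf_iff (i.1.symm.trans j.1).open_source).1
      (BoundedFrechetManifold.isMCInf_coordChange i.1 i.2 j.1 j.2)
  eq x hx := by
    change j.1 x = j.1 (i.1.symm (i.1 x))
    rw [i.1.left_inv hx.1]

theorem manifoldCharts_isAtlas [BoundedFrechetManifold F M] [ContinuousSMul ℝ F] :
    (manifoldCharts F M).IsAtlas where
  cover x := ⟨⟨chartAt F x, chart_mem_atlas F x⟩, mem_chart_source F x⟩
  injOn i := i.1.injOn
  isOpen_overlap i j := by
    rw [manifoldCharts_overlap]
    exact (i.1.symm.trans j.1).open_source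
  exists_change i j := ⟨_, manifoldCharts_isChange i j⟩

theorem manifoldCharts_target (i : atlas F M) : (manifoldCharts F M).target i = i.1.target :=
  i.1.image_source_eq_target

end Manifold

/-! ### Christoffel symbols of a fibrewise diffeomorphism -/

section Model

variable {F : Type u} [NormedAddCommGroup F] [Module ℝ F] [StandardMetric F] [ContinuousSMul ℝ F]

/-- `Ω` and `Λ` are smooth families, indexed by `U`, of mutually inverse maps `F × F → F × F`. -/
structure IsFibreIso (U : Set F) (Ω Λ : F × (F × F) → F × F) : Prop where
  isOpen : IsOpen U
  smooth : IsBCInf Ω (U ×ˢ univ)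
  smooth_inv : IsBCInf Λ (U ×ˢ univ)
  left_inv : ∀ f ∈ U, ∀ y, Λ (f, Ω (f, y)) = y
  right_inv : ∀ f ∈ U, ∀ y, Ω (f, Λ (f, y)) = y

/-- The fibre derivative at the zero jet. -/
def fibreDeriv (Ω : F × (F × F) → F × F) (f : F) : Lip (F × F) (F × F) :=
  (bderiv Ω (f, 0)).comp (Lip.inr F (F × F))

/-- The fibre derivative of the inverse at the image of the zero jet. -/
def fibreDerivInv (Ω Λ : F × (F × F) → F × F) (f : F) : Lip (F × F) (F × F) :=
  (bderiv Λ (f, Ω (f, 0))).comp (Lip.inr F (F × F))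

variable (F) in
/-- The inclusion of the velocities. -/
def velocityIncl : Lip F (F × (F × F)) := (Lip.inr F (F × F)).comp (Lip.inl F F)

/-- The second fibre derivative at the zero jet in the direction of velocities. -/
def fibreSecondDeriv (Ω : F × (F × F) → F × F) (f : F) : Lip F (Lip F (F × F)) :=
  ((Lip.compL F (F × (F × F)) (F × F)).flip (velocityIncl F)).comp
    ((bderiv (bderiv Ω) (f, 0)).comp (velocityIncl F))

/-- The Christoffel symbols `½ pr₂ ∘ (D Ω)⁻¹ ∘ D² Ω`. -/
def christoffel (Ω Λ : F × (F × F) → F × F) (f : F) : Lip F (Lip F F) :=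
  (Lip.compL F (F × F) F (((1 / 2 : ℝ) • Lip.snd F F).comp (fibreDerivInv Ω Λ f))).comp
    (fibreSecondDeriv Ω f)

theorem fibreSecondDeriv_apply (Ω : F × (F × F) → F × F) (f g h : F) :
    fibreSecondDeriv Ω f g h = bderiv (bderiv Ω) (f, 0) (0, (g, 0)) (0, (h, 0)) := rfl

theorem christoffel_apply (Ω Λ : F × (F × F) → F × F) (f g h : F) :
    christoffel Ω Λ f g h
      = (1 / 2 : ℝ) • (fibreDerivInv Ω Λ f (fibreSecondDeriv Ω f g h)).2 := rfl

namespace IsFibreIso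

variable {U : Set F} {Ω Λ : F × (F × F) → F × F}

/-- The inverse of the fibre derivative is obtained as a derivative of the smooth map `Λ`, so no
smoothness of operator inversion is required. Since the zero jet may have nonzero image, that
derivative is taken at `Ω (f, 0)`. -/
theorem isBCInf_christoffel (h : IsFibreIso U Ω Λ) : IsBCInf (christoffel Ω Λ) U := by
  have hU := h.isOpen
  have hUu : IsOpen (U ×ˢ (univ : Set (F × F))) := hU.prod isOpen_univ
  have zero : IsBCInf (fun f : F => ((f, 0) : F × (F × F))) U := IsBCInf.lip (Lip.inl F (F × F)) U
  have hΩ0 : IsBCInf (fun f => Ω (f, 0)) U := h.smooth.comp hUu zero hU fun f hf => ⟨hf, trivial⟩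
  have img : IsBCInf (fun f : F => (f, Ω (f, 0))) U := (IsBCInf.lip (Lip.id F) U).prodMk hΩ0
  have hN : IsBCInf (fibreDerivInv Ω Λ) U :=
    ((h.smooth_inv.deriv hUu).comp hUu img hU fun f hf => ⟨hf, trivial⟩).lipComp hU
      (IsBCInf.const _ U)
  have hC : IsBCInf (fibreSecondDeriv Ω) U :=
    (IsBCInf.const _ U).lipComp hU
      ((((h.smooth.deriv hUu).deriv hUu).comp hUu zero hU fun f hf => ⟨hf, trivial⟩).lipComp hU
        (IsBCInf.const _ U))
  exact (((IsBCInf.const _ U).lipComp hU hN).lip_comp (Lip.compL F (F × F) F)).lipComp hU hC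

theorem _root_.hasDirDeriv_fibre {P : F × (F × F) → F × F} (hU : IsOpen U)
    (hP : IsBCInf P (U ×ˢ univ)) {E₀ : Type*} [AddCommGroup E₀] [Module ℝ E₀] {f : F} (hf : f ∈ U)
    {c : E₀ → F × F} {p k : E₀} {y : F × F} (hc : HasDirDeriv c p k y) :
    HasDirDeriv (fun s => P (f, c s)) p k (bderiv P (f, c p) (0, y)) :=
  (hP.isBDiff (hU.prod isOpen_univ)).comp_hasDirDeriv (hU.prod isOpen_univ)
    ((hasDirDeriv_const f p k).prodMk hc) ⟨hf, trivial⟩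

theorem fibreDerivInv_fibreDeriv (h : IsFibreIso U Ω Λ) {f : F} (hf : f ∈ U) (y : F × F) :
    fibreDerivInv Ω Λ f (fibreDeriv Ω f y) = y := by
  have h1 := hasDirDeriv_fibre h.isOpen h.smooth hf ((Lip.id (F × F)).hasDirDeriv 0 y)
  have h2 := hasDirDeriv_fibre h.isOpen h.smooth_inv hf h1
  have h3 := (Lip.id (F × F)).hasDirDeriv 0 y
  simp only [Lip.id_apply, h.left_inv f hf] at h2 h3
  exact h2.unique h3

theorem fibreDeriv_fibreDerivInv (h : IsFibreIso U Ω Λ) {f : F} (hf : f ∈ U) (y : F × F) :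
    fibreDeriv Ω f (fibreDerivInv Ω Λ f y) = y := by
  have h1 := hasDirDeriv_fibre h.isOpen h.smooth_inv hf
    ((Lip.id (F × F)).hasDirDeriv (Ω (f, 0)) y)
  have h2 := hasDirDeriv_fibre h.isOpen h.smooth hf h1
  have h3 := (Lip.id (F × F)).hasDirDeriv (Ω (f, 0)) y
  simp only [Lip.id_apply, h.right_inv f hf, h.left_inv f hf] at h2 h3
  exact h2.unique h3

theorem christoffel_symm (h : IsFibreIso U Ω Λ) {f : F} (hf : f ∈ U) (g k : F) :
    christoffel Ω Λ f g k = christoffel Ω Λ f k g := by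
  rw [christoffel_apply, christoffel_apply, fibreSecondDeriv_apply, fibreSecondDeriv_apply,
    h.smooth.bderiv_symm (h.isOpen.prod isOpen_univ) ⟨hf, trivial⟩]

theorem _root_.hasDirDeriv_quadratic (v a : F) (t : ℝ) :
    HasDirDeriv (fun t : ℝ => (t • v, t ^ 2 • a)) t 1 (v, (2 * t) • a) := by
  have h1 := (hasDerivAt_id t).hasDirDeriv_smul_const v
  have h2 := (hasDerivAt_pow 2 t).hasDirDeriv_smul_const a
  simpa using h1.prodMk h2

theorem hasDirDeriv_quadratic_comp (h : IsFibreIso U Ω Λ) {f : F} (hf : f ∈ U) (v a : F) (t : ℝ) :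
    HasDirDeriv (fun t : ℝ => Ω (f, (t • v, t ^ 2 • a))) t 1
      (curveDeriv (fun t : ℝ => Ω (f, (t • v, t ^ 2 • a))) t) := by
  have := hasDirDeriv_fibre h.isOpen h.smooth hf (hasDirDeriv_quadratic v a t)
  rwa [this.curveDeriv_eq]

/-- The second derivative of `Ω` along the curve of `2`-jets `(t v, t² a)`. -/
theorem hasDirDeriv_curveDeriv_quadratic (h : IsFibreIso U Ω Λ) {f : F} (hf : f ∈ U) (v a : F) :
    HasDirDeriv (curveDeriv fun t : ℝ => Ω (f, (t • v, t ^ 2 • a))) 0 1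
      (fibreSecondDeriv Ω f v v + fibreDeriv Ω f (0, (2 : ℝ) • a)) := by
  have h1 : ∀ t : ℝ, HasDirDeriv (fun t : ℝ => (f, (t • v, t ^ 2 • a))) t 1
      (0, (v, (2 * t) • a)) := fun t =>
    (hasDirDeriv_const f t 1).prodMk (hasDirDeriv_quadratic v a t)
  have e : curveDeriv (fun t : ℝ => (f, (t • v, t ^ 2 • a))) = fun t => (0, (v, (2 * t) • a)) :=
    funext fun t => (h1 t).curveDeriv_eq
  have h2 : HasDirDeriv (curveDeriv fun t : ℝ => (f, (t • v, t ^ 2 • a))) 0 1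
      (0, (0, (2 : ℝ) • a)) := by
    rw [e]
    have := ((hasDerivAt_id (0 : ℝ)).const_mul 2).hasDirDeriv_smul_const a
    rw [mul_one] at this
    exact (hasDirDeriv_const 0 0 1).prodMk ((hasDirDeriv_const v 0 1).prodMk this)
  have := h.smooth.hasDirDeriv_curveDeriv_comp (h.isOpen.prod isOpen_univ)
    (c := fun t : ℝ => (f, (t • v, t ^ 2 • a))) (t := 0) ⟨hf, trivial⟩
    (Eventually.of_forall fun s => ⟨_, h1 s⟩) h2
  rw [e] at this
  simp only [mul_zero, zero_smul, ne_eq, OfNat.ofNat_ne_zero, not_false_eq_true, zero_pow] at this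
  exact this

/-- If `Ω` is of the form `(v, a) ↦ (L v, L a + b (v, v))` on a fibre, then `L Γ = b` on the
diagonal. -/
theorem map_christoffel (h : IsFibreIso U Ω Λ) {f : F} (hf : f ∈ U) (L : F →ₗ[ℝ] F)
    (b : F →ₗ[ℝ] F →ₗ[ℝ] F) (hΩ : ∀ v a, Ω (f, (v, a)) = (L v, L a + b v v)) (y : F) :
    L (christoffel Ω Λ f y y) = b y y := by
  -- `L` and `b` are only algebraically linear, so the difference quotient is computed explicitly:
  -- at `t ≠ 0` it is `(L v, L a + t • b v v)`.
  have hD : ∀ v a, fibreDeriv Ω f (v, a) = (L v, L a) := by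
    intro v a
    have h1 := hasDirDeriv_fibre h.isOpen h.smooth hf ((Lip.id (F × F)).hasDirDeriv 0 (v, a))
    refine HasDirDeriv.unique h1 ?_
    have h2 : Tendsto (fun t : ℝ => (L v, L a + t • b v v)) (𝓝[≠] 0) (𝓝 (L v, L a)) := by
      have : Continuous fun t : ℝ => (L v, L a + t • b v v) := by fun_prop
      simpa using (this.tendsto 0).mono_left nhdsWithin_le_nhds
    refine h2.congr' ?_
    filter_upwards [self_mem_nhdsWithin] with t ht
    have ht : t ≠ 0 := ht
    simp only [Lip.id_apply, zero_add, Prod.smul_mk, hΩ]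
    simp [smul_smul, ht]
  -- Along `(t y, 0)` the map is the explicit curve `(t L y, t² b y y)`, whose second derivative is
  -- found without continuity of `L` or `b`.
  have hC : fibreSecondDeriv Ω f y y = (0, (2 : ℝ) • b y y) := by
    have h1 := h.hasDirDeriv_curveDeriv_quadratic hf y 0
    have e : (fun t : ℝ => Ω (f, (t • y, t ^ 2 • (0 : F)))) = fun t => (t • L y, t ^ 2 • b y y) :=
      funext fun t => by simp [hΩ, smul_smul, pow_two]
    have e' : curveDeriv (fun t : ℝ => (t • L y, t ^ 2 • b y y))
        = fun t => (L y, (2 * t) • b y y) :=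
      funext fun t => (hasDirDeriv_quadratic (L y) (b y y) t).curveDeriv_eq
    rw [e, e'] at h1
    have h2 := ((hasDerivAt_id (0 : ℝ)).const_mul 2).hasDirDeriv_smul_const (b y y)
    rw [mul_one] at h2
    have := h1.unique ((hasDirDeriv_const (L y) 0 1).prodMk h2)
    rw [smul_zero, Prod.mk_zero_zero, Lip.map_zero, add_zero] at this
    exact this
  have hw := h.fibreDeriv_fibreDerivInv hf (fibreSecondDeriv Ω f y y)
  set w := fibreDerivInv Ω Λ f (fibreSecondDeriv Ω f y y) with hw'
  have hw2 : L w.2 = (2 : ℝ) • b y y := by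
    have := (hD w.1 w.2).symm.trans (hw.trans hC)
    exact (Prod.mk.inj this).2
  rw [christoffel_apply, ← hw', map_smul, hw2, smul_smul]
  norm_num

/-! ### Christoffel symbols under a change of charts -/

section Change

variable {U' W : Set F} {Ω' Λ' : F × (F × F) → F × F} {G : F → F}

/-- The transformation rule of the Christoffel symbols on the diagonal. -/
theorem christoffel_change_diag (h : IsFibreIso U Ω Λ) (h' : IsFibreIso U' Ω' Λ') {f : F}
    (hf : f ∈ U) (hf' : G f ∈ U')
    (hΩ : ∀ v a, Ω' (G f, (bderiv G f v, bderiv (bderiv G) f v v + bderiv G f a))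
      = (bderiv G f (Ω (f, (v, a))).1, bderiv G f (Ω (f, (v, a))).2)) (v : F) :
    christoffel Ω' Λ' (G f) (bderiv G f v) (bderiv G f v) + bderiv (bderiv G) f v v
      = bderiv G f (christoffel Ω Λ f v v) := by
  set A := bderiv G f with hA
  set B := bderiv (bderiv G) f with hB
  let P : Lip (F × F) (F × F) := (Lip.inl F F).comp (A.comp (Lip.fst F F))
    + (Lip.inr F F).comp (A.comp (Lip.snd F F))
  have hP : ∀ y, P y = (A y.1, A y.2) := fun y => by simp [P]
  -- The derivative of the quadratic jet change at the zero jet is `P`, because `B z.1 z.1` has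
  -- vanishing derivative there.
  have hD : ∀ y, fibreDeriv Ω' (G f) (P y) = P (fibreDeriv Ω f y) := by
    intro y
    have q : HasDirDeriv (fun z : F × F => (A z.1, B z.1 z.1 + A z.2)) 0 y (P y) := by
      have d1 := (Lip.fst F F).hasDirDeriv 0 y
      have d2 := (Lip.snd F F).hasDirDeriv 0 y
      have := (d1.lip_comp A).prodMk ((d1.bilin B d1 d1.tendsto).add (d2.lip_comp A))
      simpa [hP] using this
    have h1 := hasDirDeriv_fibre h'.isOpen h'.smooth hf' q
    have h2 := (hasDirDeriv_fibre h.isOpen h.smooth hf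
      ((Lip.id (F × F)).hasDirDeriv 0 y)).lip_comp P
    simp only [hΩ, Lip.id_apply, hP] at h1 h2
    have := h1.unique h2
    simp only [Prod.fst_zero, Prod.snd_zero, Lip.map_zero, add_zero] at this
    rw [hP, hP]
    exact this
  have hN : ∀ y, fibreDerivInv Ω' Λ' (G f) (P y) = P (fibreDerivInv Ω Λ f y) := by
    intro y
    conv_lhs => rw [← h.fibreDeriv_fibreDerivInv hf y, ← hD, h'.fibreDerivInv_fibreDeriv hf']
  -- The curve `(t v, 0)` in one chart is `(t A v, t² B v v)` in the other; the coefficient `2` is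
  -- the second derivative of `t²`, and the factor `½` in `christoffel` removes it.
  have hC : fibreSecondDeriv Ω' (G f) (A v) (A v) + fibreDeriv Ω' (G f) (0, (2 : ℝ) • B v v)
      = P (fibreSecondDeriv Ω f v v) := by
    have h1 := h'.hasDirDeriv_curveDeriv_quadratic hf' (A v) (B v v)
    have h2 := (h.hasDirDeriv_curveDeriv_quadratic hf v 0).lip_comp P
    have e : (fun t : ℝ => Ω' (G f, (t • A v, t ^ 2 • B v v)))
        = fun t => P (Ω (f, (t • v, t ^ 2 • (0 : F)))) := funext fun t => by
      rw [hP, ← hΩ]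
      simp [smul_smul, pow_two]
    have e' : curveDeriv (fun t : ℝ => P (Ω (f, (t • v, t ^ 2 • (0 : F)))))
        = fun t => P (curveDeriv (fun t : ℝ => Ω (f, (t • v, t ^ 2 • (0 : F)))) t) :=
      funext fun t => ((h.hasDirDeriv_quadratic_comp hf v 0 t).lip_comp P).curveDeriv_eq
    rw [e, e'] at h1
    have := h1.unique h2
    rw [smul_zero, Prod.mk_zero_zero, Lip.map_zero, add_zero] at this
    exact this
  have key := congrArg (fun y => (1 / 2 : ℝ) • (fibreDerivInv Ω' Λ' (G f) y).2) hC
  simp only [Lip.map_add, h'.fibreDerivInv_fibreDeriv hf', hN, Prod.snd_add, smul_add,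
    smul_smul] at key
  rw [hP] at key
  rw [christoffel_apply, christoffel_apply, Lip.map_smul, ← key]
  norm_num

/-- Polarization: expanding `B (g + k) (g + k)` leaves `2 B g k`. -/
theorem _root_.Lip.apply_apply_eq_zero_of_symm {B : Lip F (Lip F F)} (hs : ∀ g k, B g k = B k g)
    (h0 : ∀ v, B v v = 0) (g k : F) : B g k = 0 := by
  have h := h0 (g + k)
  simp only [Lip.map_add, Lip.add_apply, h0, zero_add, add_zero, hs k g] at h
  rw [← two_smul ℝ] at h
  exact (smul_eq_zero.1 h).resolve_left two_ne_zero

/-- The transformation rule of the Christoffel symbols. -/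
theorem christoffel_change (h : IsFibreIso U Ω Λ) (h' : IsFibreIso U' Ω' Λ') (hW : IsOpen W)
    (hG : IsBCInf G W) {f : F} (hfW : f ∈ W) (hf : f ∈ U) (hf' : G f ∈ U')
    (hΩ : ∀ v a, Ω' (G f, (bderiv G f v, bderiv (bderiv G) f v v + bderiv G f a))
      = (bderiv G f (Ω (f, (v, a))).1, bderiv G f (Ω (f, (v, a))).2)) (g k : F) :
    christoffel Ω' Λ' (G f) (bderiv G f g) (bderiv G f k) + bderiv (bderiv G) f g k
      = bderiv G f (christoffel Ω Λ f g k) := by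
  let A := bderiv G f
  -- The defect in the transformation rule, as a bilinear map: it is symmetric and vanishes on the
  -- diagonal.
  let B : Lip F (Lip F F) :=
    ((Lip.compL F F F).flip A).comp ((christoffel Ω' Λ' (G f)).comp A)
      + bderiv (bderiv G) f - (Lip.compL F F F A).comp (christoffel Ω Λ f)
  have hB : ∀ g k, B g k = christoffel Ω' Λ' (G f) (A g) (A k) + bderiv (bderiv G) f g k
      - A (christoffel Ω Λ f g k) := fun _ _ => rfl
  refine sub_eq_zero.1 (Lip.apply_apply_eq_zero_of_symm (B := B) (fun g k => ?_) (fun v => ?_) g k)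
  · rw [hB, hB, h'.christoffel_symm hf', h.christoffel_symm hf, hG.bderiv_symm hW hfW]
  · rw [hB, sub_eq_zero]
    exact christoffel_change_diag h h' hf hf' hΩ v

end Change

end IsFibreIso

end Model

/-! ### The linear connection defined by compatible Christoffel symbols -/

section LinearConnection

variable {ι : Type w} {M : Type v} {F : Type u} [NormedAddCommGroup F] [Module ℝ F]
  [StandardMetric F] [ContinuousSMul ℝ F] {A : Charts ι M F}

theorem Charts.IsAtlas.bderiv_tangent_change (hA : A.IsAtlas) {i j : ι} {G : F → F}
    (hG : A.IsChange i j G) {f : F} (hf : f ∈ A.overlap i j) (g h k : F) :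
    bderiv (fun z : F × F => (G z.1, bderiv G z.1 z.2)) (f, g) (h, k)
      = (bderiv G f h, bderiv (bderiv G) f h g + bderiv G f k) := by
  have hO := hA.isOpen_overlap i j
  have hsm := (hA.tangent_isChange hG).smooth
  have hO' := hA.tangent.isOpen_overlap i j
  have hfg : (f, g) ∈ (tangentCharts A).overlap i j := by
    rw [hA.tangent_overlap]
    exact ⟨hf, trivial⟩
  refine (hsm.hasDirDeriv hO' hfg (h, k)).unique ?_
  have d1 := (Lip.fst F F).hasDirDeriv (f, g) (h, k)
  have d2 := (Lip.snd F F).hasDirDeriv (f, g) (h, k)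
  exact ((hG.smooth.isBDiff hO).comp_hasDirDeriv hO d1 hf).prodMk
    (HasDirDeriv.bilin (Lip.id (Lip F F))
      (((hG.smooth.deriv hO).isBDiff hO).comp_hasDirDeriv hO d1 hf) d2 d2.tendsto)

/-- A value prescribed in one chart is correct in every chart: under the change `G` the component
`k` acquires `D²G(h, g)`, which by symmetry is the term that `Γ` acquires with the opposite sign. -/
theorem Charts.IsAtlas.exists_isLinearConnection (hA : A.IsAtlas) (Γ : ι → F → Lip F (Lip F F))
    (hΓ : ∀ i, IsBCInf (Γ i) (A.target i))
    (hc : ∀ i j G, A.IsChange i j G → ∀ f ∈ A.overlap i j, ∀ g h,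
      Γ j (G f) (bderiv G f g) (bderiv G f h) + bderiv (bderiv G) f g h
        = bderiv G f (Γ i f g h)) :
    ∃ K, IsLinearConnection A K fun i z => Γ i z.1 z.2 := by
  have hK : ∀ ξ : TBundle (tangentCharts A), ∃ η : TBundle A, η.base = ξ.base.base ∧
      ∀ i, ξ.base.base ∈ A.dom i → η.deriv i 1 = (ξ.deriv i 1).2
        + Γ i (A.coord i ξ.base.base) (ξ.base.deriv i 1) (ξ.deriv i 1).1 := by
    intro ξ
    obtain ⟨i, hi⟩ := hA.cover ξ.base.base
    obtain ⟨η, hη, hηi⟩ := hA.exists_jet_one hi ((ξ.deriv i 1).2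
        + Γ i (A.coord i ξ.base.base) (ξ.base.deriv i 1) (ξ.deriv i 1).1)
    refine ⟨η, hη, fun j hj => ?_⟩
    obtain ⟨G, hG⟩ := hA.exists_change i j
    have hf := Charts.IsAtlas.coord_mem_overlap hi hj
    have e1 : ξ.deriv j 1 = bderiv (fun z : F × F => (G z.1, bderiv G z.1 z.2))
        (A.coord i ξ.base.base, ξ.base.deriv i 1) ((ξ.deriv i 1).1, (ξ.deriv i 1).2) :=
      hA.tangent.deriv_one_change le_rfl (hA.tangent_isChange hG) ξ hi hj
    rw [hA.bderiv_tangent_change hG hf] at e1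
    have hO := hA.isOpen_overlap i j
    rw [hA.deriv_one_change le_rfl hG η (hη ▸ hi) (hη ▸ hj), e1,
      hA.deriv_one_change le_rfl hG ξ.base hi hj, hG.eq _ ⟨hi, hj⟩, hη, hηi, Lip.map_add,
      ← hc i j G hG _ hf, hG.smooth.bderiv_symm hO hf]
    dsimp only
    abel
  choose K hKb hKd using hK
  have hKpre : ∀ j, K ⁻¹' (tangentCharts A).dom j = (tangentCharts (tangentCharts A)).dom j := by
    intro j
    ext ξ
    change (K ξ).base ∈ A.dom j ↔ ξ.base.base ∈ A.dom j
    rw [hKb]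
  refine ⟨K, ⟨⟨fun i j => ?_, hKb, fun i => ?_, ?_⟩, ?_⟩⟩
  · obtain ⟨G, hG⟩ := hA.exists_change i j
    have hO := hA.isOpen_overlap i j
    have hO' := hA.tangent.tangent.isOpen_overlap i j
    rw [hKpre]
    change IsOpen ((tangentCharts (tangentCharts A)).overlap i j) ∧
      ∃ G' : (F × F) × (F × F) → F × F,
        IsMCInf G' ((tangentCharts (tangentCharts A)).overlap i j) ∧ _
    refine ⟨hO', fun z => (G z.1.1, bderiv G z.1.1 (z.2.2 + Γ i z.1.1 z.1.2 z.2.1)), ?_, ?_⟩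
    · rw [isMCInf_iff hO']
      have eO : (tangentCharts (tangentCharts A)).overlap i j
          = (A.overlap i j ×ˢ univ) ×ˢ univ := by
        rw [hA.tangent.tangent_overlap, hA.tangent_overlap]
      rw [eO] at hO' ⊢
      -- Coefficients depending only on the base point are smooth on the chart domain of `T(TM)`.
      have lift : ∀ {H : Type u} [NormedAddCommGroup H] [Module ℝ H] [StandardMetric H]
          {P : F → H}, IsBCInf P (A.overlap i j) →
          IsBCInf (fun z : (F × F) × (F × F) => P z.1.1) ((A.overlap i j ×ˢ univ) ×ˢ univ) :=
        fun hP => (hP.comp_fst hO isOpen_univ).comp_fst (hO.prod isOpen_univ) isOpen_univ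
      have hsub : A.overlap i j ⊆ A.target i := image_mono inter_subset_left
      refine (lift hG.smooth).prodMk ((lift (hG.smooth.deriv hO)).apply hO' (.add ?_ ?_))
      · exact IsBCInf.lip ((Lip.snd F F).comp (Lip.snd (F × F) (F × F))) _
      · exact ((lift ((hΓ i).mono hsub)).apply hO'
          (IsBCInf.lip ((Lip.snd F F).comp (Lip.fst (F × F) (F × F))) _)).apply hO'
          (IsBCInf.lip ((Lip.fst F F).comp (Lip.snd (F × F) (F × F))) _)
    · rintro ξ ⟨hi, hj⟩
      have hi : ξ.base.base ∈ A.dom i := hi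
      have hj : ξ.base.base ∈ A.dom j := hj
      have hi' : (K ξ).base ∈ A.dom i := hKb ξ ▸ hi
      have hj' : (K ξ).base ∈ A.dom j := hKb ξ ▸ hj
      refine Prod.ext ?_ ?_
      · change A.coord j (K ξ).base = G (A.coord i ξ.base.base)
        rw [hKb, hG.eq _ ⟨hi, hj⟩]
      · change (K ξ).deriv j 1 = bderiv G (A.coord i ξ.base.base) ((ξ.deriv i 1).2
          + Γ i (A.coord i ξ.base.base) (ξ.base.deriv i 1) (ξ.deriv i 1).1)
        rw [hA.deriv_one_change le_rfl hG (K ξ) hi' hj', hKd ξ i hi, hKb]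
  · have ht := hA.isOpen_target i
    rw [isMCInfLip_iff (ht.prod isOpen_univ)]
    exact ((hΓ i).comp_fst ht isOpen_univ).apply (ht.prod isOpen_univ)
      (IsBCInf.lip (Lip.snd F F) _)
  · rintro i ξ hi f g h k e
    obtain ⟨e1, e2⟩ := Prod.mk.inj e
    obtain ⟨rfl, rfl⟩ := Prod.mk.inj e1
    have e2 : ξ.deriv i 1 = (h, k) := e2
    refine Prod.ext (congrArg (A.coord i) (hKb ξ)) ?_
    change (K ξ).deriv i 1 = _
    rw [hKd ξ i hi, e2]
  · exact fun i f _ => ⟨fun g h => (Γ i f).map_add g h, fun c g => (Γ i f).map_smul c g⟩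

end LinearConnection

/-! ### The local representation of a vector bundle isomorphism `T²M → TM ⊕ TM` -/

section LocalRep

/-- Expresses a map in injective coordinates; values off the image of `s` are arbitrary and play no
role. -/
theorem Set.InjOn.exists_factor {α β γ : Type*} [Nonempty β] {g : α → γ} {s : Set α}
    (hg : InjOn g s) (f : α → β) : ∃ G : γ → β, ∀ x ∈ s, f x = G (g x) :=
  ⟨Function.extend (s.domRestrict g) (s.domRestrict f) fun _ => Classical.arbitrary β, fun x hx =>
    ((injOn_iff_injective.1 hg).extend_apply (s.domRestrict f) _ ⟨x, hx⟩).symm⟩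

variable {ι : Type w} {M : Type v} {F : Type u} [NormedAddCommGroup F] [Module ℝ F]
  [StandardMetric F] [ContinuousSMul ℝ F] {A : Charts ι M F}

theorem Charts.IsAtlas.whitney_ext (hA : A.IsAtlas) {i : ι} {z z' : WhitneyT A}
    (hi : z.proj ∈ A.dom i) (h0 : z.proj = z'.proj)
    (h : (whitneyTrivs A).fib i z = (whitneyTrivs A).fib i z') : z = z' := by
  obtain ⟨h1, h2⟩ := Prod.mk.inj h
  refine Subtype.ext (Prod.ext (hA.jet_one_ext h0 hi h1) (hA.jet_one_ext ?_ ?_ h2))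
  · rw [← z.2, ← z'.2]
    exact h0
  · rw [← z.2]
    exact hi

theorem Charts.IsAtlas.exists_whitney (hA : A.IsAtlas) {i : ι} {p : M} (hp : p ∈ A.dom i)
    (w : F × F) : ∃ z : WhitneyT A, z.proj = p ∧ (whitneyTrivs A).fib i z = w := by
  obtain ⟨ξ, hξ, h1⟩ := hA.exists_jet_one hp w.1
  obtain ⟨η, hη, h2⟩ := hA.exists_jet_one hp w.2
  exact ⟨⟨(ξ, η), hξ.trans hη.symm⟩, hξ, Prod.ext h1 h2⟩

variable [TopologicalSpace M] {κ : Type*} {𝒯 : Trivs κ M (T2Bundle A) (F × F)}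

/-- The fibre component of a local trivialization in coordinates. -/
theorem IsVectorBundle.exists_isBCInf_fib (hA : A.IsAtlas)
    (h𝒯 : IsVectorBundle A (tangent2Charts A) Jet.base 𝒯) (i : ι) (k : κ)
    (hO : IsOpen (A.coord i '' (A.dom i ∩ 𝒯.base k))) :
    ∃ P Q : F × (F × F) → F × F,
      IsBCInf P ((A.coord i '' (A.dom i ∩ 𝒯.base k)) ×ˢ univ) ∧
      IsBCInf Q ((A.coord i '' (A.dom i ∩ 𝒯.base k)) ×ˢ univ) ∧
      (∀ ξ : T2Bundle A, ξ.base ∈ A.dom i ∩ 𝒯.base k →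
        𝒯.fib k ξ = P (A.coord i ξ.base, (ξ.deriv i 1, ξ.deriv i 2))) ∧
      ∀ ξ : T2Bundle A, ξ.base ∈ A.dom i ∩ 𝒯.base k →
        (ξ.deriv i 1, ξ.deriv i 2) = Q (A.coord i ξ.base, 𝒯.fib k ξ) := by
  obtain ⟨τ, hτ, hτ1, hτ2⟩ := h𝒯.triv k
  set V := (A.coord i '' (A.dom i ∩ 𝒯.base k)) ×ˢ (univ : Set (F × F)) with hV
  have hVo : IsOpen V := hO.prod isOpen_univ
  obtain ⟨-, P, hP, hP'⟩ := hτ1 i i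
  obtain ⟨-, Q, hQ, hQ'⟩ := hτ2 i i
  -- The chart image on which smoothness is given contains all of `V`, because every pair `(v, a)`
  -- is realized by a 2-jet over each base point.
  have s1 : V ⊆ (Charts.restrict (tangent2Charts A) (Jet.base ⁻¹' 𝒯.base k)).coord i ''
      ((Charts.restrict (tangent2Charts A) (Jet.base ⁻¹' 𝒯.base k)).dom i ∩
        τ ⁻¹' ((Charts.restrict A (𝒯.base k)).prod (F × F)).dom i) := by
    rintro ⟨_, v, a⟩ ⟨⟨p, ⟨hi, hk⟩, rfl⟩, -⟩
    obtain ⟨ξ, rfl, rfl, rfl⟩ := hA.exists_jet_two hi v a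
    refine ⟨⟨ξ, hk⟩, ⟨hi, ?_⟩, rfl⟩
    change ((τ ⟨ξ, hk⟩).1 : M) ∈ A.dom i
    rw [(hτ _).1]
    exact hi
  have s2 : V ⊆ ((Charts.restrict A (𝒯.base k)).prod (F × F)).coord i ''
      (((Charts.restrict A (𝒯.base k)).prod (F × F)).dom i ∩
        τ.symm ⁻¹' (Charts.restrict (tangent2Charts A) (Jet.base ⁻¹' 𝒯.base k)).dom i) := by
    rintro ⟨_, y⟩ ⟨⟨p, ⟨hi, hk⟩, rfl⟩, -⟩
    refine ⟨(⟨p, hk⟩, y), ⟨hi, ?_⟩, rfl⟩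
    change (τ.symm (⟨p, hk⟩, y)).1.base ∈ A.dom i
    rw [← (hτ _).1, Equiv.apply_symm_apply]
    exact hi
  have o1 := (hτ1 i i).1
  have o2 := (hτ2 i i).1
  refine ⟨fun z => (P z).2, fun z => (Q z).2,
    (((isMCInf_iff o1).1 hP).mono s1).lip_comp (Lip.snd F (F × F)),
    (((isMCInf_iff o2).1 hQ).mono s2).lip_comp (Lip.snd F (F × F)), ?_, ?_⟩
  · rintro ξ ⟨hi, hk⟩
    have := hP' ⟨ξ, hk⟩ ⟨hi, by
      change ((τ ⟨ξ, hk⟩).1 : M) ∈ A.dom i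
      rw [(hτ _).1]
      exact hi⟩
    rw [← (hτ ⟨ξ, hk⟩).2]
    exact congrArg Prod.snd this
  · rintro ξ ⟨hi, hk⟩
    have e1 : A.coord i ((τ ⟨ξ, hk⟩).1 : M) = A.coord i ξ.base := by rw [(hτ _).1]
    have := hQ' (τ ⟨ξ, hk⟩) ⟨by
      change ((τ ⟨ξ, hk⟩).1 : M) ∈ A.dom i
      rw [(hτ _).1]
      exact hi, by
      rw [mem_preimage, Equiv.symm_apply_apply]
      exact hi⟩
    rw [Equiv.symm_apply_apply] at this
    have := congrArg Prod.snd this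
    change (ξ.deriv i 1, ξ.deriv i 2)
      = (Q (A.coord i ((τ ⟨ξ, hk⟩).1 : M), (τ ⟨ξ, hk⟩).2)).2 at this
    rwa [e1, (hτ _).2] at this

/-- The maps are first defined over the whole chart, where coordinates are injective. Smoothness is
local: near each base point, a trivialization of `T²M` written in jet coordinates is followed by the
operator representing `Ψ`, which depends smoothly on the base point. -/
theorem IsBundleIso.exists_isFibreIso (hA : A.IsAtlas)
    (hopen : ∀ i S, IsOpen S → IsOpen (A.coord i '' (A.dom i ∩ S)))
    (h𝒯 : IsVectorBundle A (tangent2Charts A) Jet.base 𝒯) {Ψ : T2Bundle A ≃ WhitneyT A}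
    (hΨ : IsBundleIso A Jet.base 𝒯 WhitneyT.proj (whitneyTrivs A) Ψ) (i : ι) :
    ∃ Ω Λ : F × (F × F) → F × F, IsFibreIso (A.target i) Ω Λ ∧
      ∀ ξ : T2Bundle A, ξ.base ∈ A.dom i →
        (whitneyTrivs A).fib i (Ψ ξ) = Ω (A.coord i ξ.base, (ξ.deriv i 1, ξ.deriv i 2)) := by
  have inj1 : InjOn (fun ξ : T2Bundle A => (A.coord i ξ.base, (ξ.deriv i 1, ξ.deriv i 2)))
      {ξ | ξ.base ∈ A.dom i} := by
    intro ξ hξ η hη e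
    obtain ⟨e1, e2⟩ := Prod.mk.inj e
    obtain ⟨e2, e3⟩ := Prod.mk.inj e2
    exact hA.jet_two_ext (hA.injOn i hξ hη e1) hξ e2 e3
  have inj2 : InjOn (fun z : WhitneyT A => (A.coord i z.proj, (whitneyTrivs A).fib i z))
      {z | z.proj ∈ A.dom i} := by
    intro z hz z' hz' e
    obtain ⟨e1, e2⟩ := Prod.mk.inj e
    exact hA.whitney_ext hz (hA.injOn i hz hz' e1) e2
  obtain ⟨Ω, hΩ⟩ := inj1.exists_factor fun ξ => (whitneyTrivs A).fib i (Ψ ξ)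
  obtain ⟨Λ, hΛ⟩ := inj2.exists_factor fun z => ((Ψ.symm z).deriv i 1, (Ψ.symm z).deriv i 2)
  have b1 : ∀ ξ, (Ψ ξ).proj = ξ.base := hΨ.1.1
  have b2 : ∀ z, (Ψ.symm z).base = z.proj := hΨ.2.1
  refine ⟨Ω, Λ, ⟨hA.isOpen_target i, IsBCInf.of_locally ?_, IsBCInf.of_locally ?_, ?_, ?_⟩, hΩ⟩
  · rintro ⟨_, y⟩ ⟨⟨p, hp, rfl⟩, -⟩
    obtain ⟨k, hk⟩ := h𝒯.cover p
    have hO := hopen i _ (h𝒯.isOpen_base k)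
    obtain ⟨P, -, hP, -, hP', -⟩ := h𝒯.exists_isBCInf_fib hA i k hO
    obtain ⟨T, hT, hT'⟩ := hΨ.1.2 k i
    obtain ⟨S, hS, hS'⟩ := hT i
    have eS : A.dom i ∩ (𝒯.base k ∩ (whitneyTrivs A).base i) = A.dom i ∩ 𝒯.base k := by
      change A.dom i ∩ (𝒯.base k ∩ A.dom i) = _
      rw [inter_comm (𝒯.base k), ← inter_assoc, inter_self]
    rw [eS] at hS hS'
    rw [isMCInfLip_iff hO] at hS
    refine ⟨_, hO.prod isOpen_univ, ⟨⟨p, ⟨hp, hk⟩, rfl⟩, trivial⟩,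
      -- Locally `Ω (f, y) = S f (P (f, y))`, an evaluation of a smooth operator family.
      ((hS.comp_fst hO isOpen_univ).apply (hO.prod isOpen_univ) hP).congr
        (hO.prod isOpen_univ) ?_⟩
    rintro ⟨_, v, a⟩ ⟨⟨q, hq, rfl⟩, -⟩
    obtain ⟨ξ, rfl, rfl, rfl⟩ := hA.exists_jet_two hq.1 v a
    dsimp only
    rw [← hΩ ξ hq.1, hT' ξ ⟨hq.2, hq.1⟩, hS' _ hq, hP' ξ hq]
  · rintro ⟨_, y⟩ ⟨⟨p, hp, rfl⟩, -⟩
    obtain ⟨k, hk⟩ := h𝒯.cover p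
    have hO := hopen i _ (h𝒯.isOpen_base k)
    obtain ⟨-, Q, -, hQ, -, hQ'⟩ := h𝒯.exists_isBCInf_fib hA i k hO
    obtain ⟨T, hT, hT'⟩ := hΨ.2.2 i k
    obtain ⟨S, hS, hS'⟩ := hT i
    have eS : A.dom i ∩ ((whitneyTrivs A).base i ∩ 𝒯.base k) = A.dom i ∩ 𝒯.base k := by
      change A.dom i ∩ (A.dom i ∩ 𝒯.base k) = _
      rw [← inter_assoc, inter_self]
    rw [eS] at hS hS'
    rw [isMCInfLip_iff hO] at hS
    have hOu : IsOpen ((A.coord i '' (A.dom i ∩ 𝒯.base k)) ×ˢ (univ : Set (F × F))) :=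
      hO.prod isOpen_univ
    refine ⟨_, hOu, ⟨⟨p, ⟨hp, hk⟩, rfl⟩, trivial⟩,
      -- The inverse runs in the opposite order: `Λ (f, w) = Q (f, S f w)`, with `S` representing
      -- `Ψ.symm`.
      (hQ.comp hOu ((IsBCInf.lip (Lip.fst F (F × F)) _).prodMk
        ((hS.comp_fst hO isOpen_univ).apply hOu (IsBCInf.lip (Lip.snd F (F × F)) _))) hOu
        fun z hz => ⟨hz.1, trivial⟩).congr hOu ?_⟩
    rintro ⟨_, w⟩ ⟨⟨q, hq, rfl⟩, -⟩
    obtain ⟨z, rfl, rfl⟩ := hA.exists_whitney hq.1 w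
    have := hQ' (Ψ.symm z) (by rw [b2]; exact hq)
    rw [hT' z hq, b2, hS' _ hq] at this
    dsimp only [Lip.fst_apply, Lip.snd_apply]
    rw [← hΛ z hq.1, this]
  · rintro _ ⟨p, hp, rfl⟩ ⟨v, a⟩
    obtain ⟨ξ, rfl, rfl, rfl⟩ := hA.exists_jet_two hp v a
    have := hΛ (Ψ ξ) (by rw [mem_ofPred_eq, b1]; exact hp)
    rw [b1, hΩ ξ hp, Equiv.symm_apply_apply] at this
    exact this.symm
  · rintro _ ⟨p, hp, rfl⟩ w
    obtain ⟨z, rfl, rfl⟩ := hA.exists_whitney hp w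
    have := hΩ (Ψ.symm z) (by rw [mem_ofPred_eq, b2]; exact hp)
    rw [b2, hΛ z hp, Equiv.apply_symm_apply] at this
    exact this.symm

end LocalRep

section LocalRep

variable {ι : Type w} {M : Type v} {F : Type u} [NormedAddCommGroup F] [Module ℝ F]
  [StandardMetric F] [ContinuousSMul ℝ F] {A : Charts ι M F}

/-- The change of the local representations of a map `T²M → TM ⊕ TM` over the identity. -/
theorem Charts.IsAtlas.fibre_rep_change (hA : A.IsAtlas) {Ψ : T2Bundle A → WhitneyT A}
    (hΨ : ∀ ξ, (Ψ ξ).proj = ξ.base) {Ω : ι → F × (F × F) → F × F}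
    (hΩ : ∀ i, ∀ ξ : T2Bundle A, ξ.base ∈ A.dom i →
      (whitneyTrivs A).fib i (Ψ ξ) = Ω i (A.coord i ξ.base, (ξ.deriv i 1, ξ.deriv i 2)))
    {i j : ι} {G : F → F} (hG : A.IsChange i j G) {f : F} (hf : f ∈ A.overlap i j) (v a : F) :
    Ω j (G f, (bderiv G f v, bderiv (bderiv G) f v v + bderiv G f a))
      = (bderiv G f (Ω i (f, (v, a))).1, bderiv G f (Ω i (f, (v, a))).2) := by
  obtain ⟨p, ⟨hi, hj⟩, rfl⟩ := hf
  obtain ⟨ξ, rfl, rfl, rfl⟩ := hA.exists_jet_two hi v a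
  have e1 : (Ψ ξ).1.1.base = ξ.base := hΨ ξ
  have e2 : (Ψ ξ).1.2.base = ξ.base := (Ψ ξ).2.symm.trans e1
  rw [← hA.deriv_two_change hG ξ hi hj, ← hA.deriv_one_change one_le_two hG ξ hi hj,
    ← hG.eq _ ⟨hi, hj⟩, ← hΩ j ξ hj, ← hΩ i ξ hi]
  have c1 := hA.deriv_one_change le_rfl hG (Ψ ξ).1.1 (e1 ▸ hi) (e1 ▸ hj)
  have c2 := hA.deriv_one_change le_rfl hG (Ψ ξ).1.2 (e2 ▸ hi) (e2 ▸ hj)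
  rw [e1] at c1
  rw [e2] at c2
  exact Prod.ext c1 c2

end LocalRep

end

/-! ### Construction of the linear connection -/

theorem mainTheorem3
    {F : Type u} [NormedAddCommGroup F] [Module ℝ F] [ContinuousSMul ℝ F] [CompleteSpace F]
    [StandardMetric F]
    {M : Type v} [TopologicalSpace M] [ChartedSpace F M] [BoundedFrechetManifold F M]
    {κ : Type w} (𝒯 : Trivs κ M (T2Bundle (manifoldCharts F M)) (F × F))
    (h𝒯 : IsVectorBundle (manifoldCharts F M) (tangent2Charts (manifoldCharts F M)) Jet.base 𝒯)
    (Ψ : T2Bundle (manifoldCharts F M) ≃ WhitneyT (manifoldCharts F M))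
    (hΨ : IsBundleIso (manifoldCharts F M) Jet.base 𝒯 WhitneyT.proj
      (whitneyTrivs (manifoldCharts F M)) Ψ) :
    ∃ (K : TBundle (tangentCharts (manifoldCharts F M)) → TBundle (manifoldCharts F M))
      (τ : atlas F M → F × F → Lip F F) (Γ : atlas F M → F → Lip F (Lip F F)),
      IsLinearConnection (manifoldCharts F M) K τ ∧
      IsChristoffel (manifoldCharts F M) τ Γ ∧
      ChristoffelCompatible Γ ∧
      (∀ i : atlas F M, ∀ x ∈ i.1.target, ∀ g h : F, Γ i x g h = Γ i x h g) ∧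
      (∀ (i : atlas F M) (p : M), p ∈ i.1.source →
        ∀ (L : F →ₗ[ℝ] F) (b : F →ₗ[ℝ] F →ₗ[ℝ] F),
        (∀ ξ : T2Bundle (manifoldCharts F M), ξ.base = p →
          (whitneyTrivs (manifoldCharts F M)).fib i (Ψ ξ)
            = (L (ξ.deriv i 1), L (ξ.deriv i 2) + b (ξ.deriv i 1) (ξ.deriv i 1))) →
        ∀ y : F, L (Γ i (i.1 p) y y) = b y y) := by
  have hA : (manifoldCharts F M).IsAtlas := manifoldCharts_isAtlas
  have hopen : ∀ (i : atlas F M) (S : Set M), IsOpen S →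
      IsOpen ((manifoldCharts F M).coord i '' ((manifoldCharts F M).dom i ∩ S)) :=
    fun i S hS => i.1.isOpen_image_of_subset_source (i.1.open_source.inter hS) inter_subset_left
  choose Ω Λ hΩΛ hΩ using fun i => hΨ.exists_isFibreIso hA hopen h𝒯 i
  have hc : ∀ i j G, (manifoldCharts F M).IsChange i j G →
      ∀ f ∈ (manifoldCharts F M).overlap i j, ∀ g h,
      christoffel (Ω j) (Λ j) (G f) (bderiv G f g) (bderiv G f h) + bderiv (bderiv G) f g h
        = bderiv G f (christoffel (Ω i) (Λ i) f g h) := by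
    intro i j G hG f hf g h
    have hf' : G f ∈ (manifoldCharts F M).target j := by
      obtain ⟨p, hp, rfl⟩ := hf
      rw [← hG.eq p hp]
      exact ⟨p, hp.2, rfl⟩
    exact (hΩΛ i).christoffel_change (hΩΛ j) (hA.isOpen_overlap i j) hG.smooth hf
      (image_mono inter_subset_left hf) hf' (hA.fibre_rep_change hΨ.1.1 hΩ hG hf) g h
  obtain ⟨K, hK⟩ := hA.exists_isLinearConnection (fun i => christoffel (Ω i) (Λ i))
    (fun i => (hΩΛ i).isBCInf_christoffel) hc
  refine ⟨K, _, fun i => christoffel (Ω i) (Λ i), hK, fun i f _ g h => rfl, ?_, ?_, ?_⟩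
  · intro i j f hf g h
    dsimp only
    -- The indices are exchanged, since `Θ = φ_i ∘ φ_j⁻¹` changes from the chart `j` to the chart
    -- `i`.
    have hG := manifoldCharts_isChange j i
    have hO := hA.isOpen_overlap j i
    rw [inter_comm] at hf
    have hf : f ∈ (manifoldCharts F M).overlap j i := hf
    have e : (fun x => bderiv (i.1 ∘ j.1.symm) x g)
        =ᶠ[𝓝 f] fun x => dirDeriv (i.1 ∘ j.1.symm) x g := by
      filter_upwards [hO.mem_nhds hf] with x hx
      exact (hG.smooth.dirDeriv_eq hO hx g).symm
    -- Differentiating `x ↦ DΘ(x) g` in the direction `h` yields the second derivative with `h` in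
    -- the first slot; symmetry restores the order used in `hc`.
    have e2 : dirDeriv (fun x => dirDeriv (i.1 ∘ j.1.symm) x g) f h
        = bderiv (bderiv (i.1 ∘ j.1.symm)) f g h := by
      rw [hG.smooth.bderiv_symm hO hf]
      refine HasDirDeriv.dirDeriv_eq (HasDirDeriv.congr_of_eventuallyEq ?_ e)
      have h1 := (hG.smooth.deriv hO).hasDirDeriv hO hf h
      exact h1.lip_comp ((Lip.id (Lip F F)).flip g)
    rw [e2, hG.smooth.dirDeriv_eq hO hf, hG.smooth.dirDeriv_eq hO hf,
      hG.smooth.dirDeriv_eq hO hf]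
    exact hc j i _ hG f hf g h
  · intro i x hx g h
    exact (hΩΛ i).christoffel_symm (by rwa [manifoldCharts_target]) g h
  · intro i p hp L b hL y
    refine (hΩΛ i).map_christoffel ⟨p, hp, rfl⟩ L b (fun v a => ?_) y
    obtain ⟨ξ, hξ, rfl, rfl⟩ := hA.exists_jet_two (i := i) hp v a
    subst hξ
    exact (hΩ i ξ hp).symm.trans (hL ξ rfl)
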